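/- **Lemma.** For a finite set $S$ of $n$ points in the plane and a line segment $L$ of finite slope with end-points $a=(a_x,a_y)$, $b=(b_x,b_y)$, $a_x\neq b_x$, let $L^{+}$ be the set of points of the closed vertical strip $\min(a_x,b_x)\le x\le\max(a_x,b_x)$ that lie strictly above the line through $a$ and $b$. The *one-sided segment sweeping query* $Q(L)$ asks whether $S\cap L^{+}$ is empty. After a preprocessing of $S$ that takes $O(n\log n)$ time, every such query can be answered in $O(\log n)$ time, and the total storage is $O(n\log\log n)$. The model of computation is the real RAM. A program is one finite text, used for all $n$. It works with finitely many registers and arrays that hold either real numbers of unlimited precision or natural numbers of $O(\log n)$ bits. In unit time it performs one of $+,-,\cdot,/$ on reals, one of $+,-,\cdot$ and division with remainder discarded on natural numbers, a comparison, or an access to an array cell whose index is a computed natural number. The only constants are fixed natural numbers, and there is no rounding of reals to integers. Running times are worst-case; storage is the total number of array cells available to preprocessing and queries together, including the input. The points are given as an unsorted list $p_1,\dots,p_n$ (repetitions allowed, $S=\{p_1,\dots,p_n\}$). After the preprocessing, arbitrarily many queries can be posed one after the other, each chosen after the earlier ones are answered, and each is answered correctly within the stated time. -/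

import Mathlib

/-! A real random access machine: finite programs over finitely many registers and arrays, holding
either real numbers of unlimited precision or natural numbers of a bounded word length. There is
no rounding of reals to integers, programs contain only integer constants, and every operation
and every memory access has unit cost. -/

namespace RealRAM

/-- A memory configuration. Registers and arrays are named by natural numbers occurring literally
in the program text, so that a program uses only finitely many of them; the cells of an array are
addressed by computed words. -/
structure State where
  /-- word registers -/
  nreg : ℕ → ℕ
  /-- real registers -/
  rreg : ℕ → ℝ
  /-- word arrays -/
  narr : ℕ → ℕ → ℕ
  /-- real arrays -/
  rarr : ℕ → ℕ → ℝ

/-- Word expressions. -/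
inductive NExp where
  | const (k : ℕ)
  | reg (i : ℕ)
  | get (a : ℕ) (e : NExp)
  | add (e f : NExp)
  | sub (e f : NExp)
  | mul (e f : NExp)
  | div (e f : NExp)

/-- Value of a word expression (subtraction is truncated, division rounds down). -/
def NExp.val (s : State) : NExp → ℕ
  | const k => k
  | reg i => s.nreg i
  | get a e => s.narr a (e.val s)
  | add e f => e.val s + f.val s
  | sub e f => e.val s - f.val s
  | mul e f => e.val s * f.val s
  | div e f => e.val s / f.val s

/-- Number of operations needed to evaluate a word expression. -/
def NExp.cost : NExp → ℕ
  | const _ => 1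
  | reg _ => 1
  | get _ e => e.cost + 1
  | add e f => e.cost + f.cost + 1
  | sub e f => e.cost + f.cost + 1
  | mul e f => e.cost + f.cost + 1
  | div e f => e.cost + f.cost + 1

/-- With words of `w` bits and arrays of `m` cells the evaluation succeeds: no overflow, no access
outside an array, no division by zero. -/
def NExp.Ok (w m : ℕ) (s : State) : NExp → Prop
  | const k => k < 2 ^ w
  | reg i => s.nreg i < 2 ^ w
  | get a e => e.Ok w m s ∧ e.val s < m ∧ s.narr a (e.val s) < 2 ^ w
  | add e f => e.Ok w m s ∧ f.Ok w m s ∧ e.val s + f.val s < 2 ^ w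
  | sub e f => e.Ok w m s ∧ f.Ok w m s
  | mul e f => e.Ok w m s ∧ f.Ok w m s ∧ e.val s * f.val s < 2 ^ w
  | div e f => e.Ok w m s ∧ f.Ok w m s ∧ f.val s ≠ 0

/-- Real expressions. -/
inductive RExp where
  | const (k : ℕ)
  | reg (i : ℕ)
  | get (a : ℕ) (e : NExp)
  | add (e f : RExp)
  | sub (e f : RExp)
  | mul (e f : RExp)
  | div (e f : RExp)

/-- Value of a real expression. -/
noncomputable def RExp.val (s : State) : RExp → ℝ
  | const k => (k : ℝ)
  | reg i => s.rreg i
  | get a e => s.rarr a (e.val s)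
  | add e f => e.val s + f.val s
  | sub e f => e.val s - f.val s
  | mul e f => e.val s * f.val s
  | div e f => e.val s / f.val s

/-- Number of operations needed to evaluate a real expression. -/
def RExp.cost : RExp → ℕ
  | const _ => 1
  | reg _ => 1
  | get _ e => e.cost + 1
  | add e f => e.cost + f.cost + 1
  | sub e f => e.cost + f.cost + 1
  | mul e f => e.cost + f.cost + 1
  | div e f => e.cost + f.cost + 1

/-- The evaluation of a real expression succeeds. -/
def RExp.Ok (w m : ℕ) (s : State) : RExp → Prop
  | const _ => True
  | reg _ => True
  | get _ e => e.Ok w m s ∧ e.val s < m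
  | add e f => e.Ok w m s ∧ f.Ok w m s
  | sub e f => e.Ok w m s ∧ f.Ok w m s
  | mul e f => e.Ok w m s ∧ f.Ok w m s
  | div e f => e.Ok w m s ∧ f.Ok w m s ∧ f.val s ≠ 0

/-- Tests. -/
inductive Test where
  | eqN (e f : NExp)
  | ltN (e f : NExp)
  | eqR (e f : RExp)
  | ltR (e f : RExp)
  | not (b : Test)
  | and (b c : Test)

/-- The test holds. -/
def Test.Holds (s : State) : Test → Prop
  | eqN e f => e.val s = f.val s
  | ltN e f => e.val s < f.val s
  | eqR e f => e.val s = f.val s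
  | ltR e f => e.val s < f.val s
  | not b => ¬ b.Holds s
  | and b c => b.Holds s ∧ c.Holds s

/-- Number of operations charged for a test. -/
def Test.cost : Test → ℕ
  | eqN e f => e.cost + f.cost + 1
  | ltN e f => e.cost + f.cost + 1
  | eqR e f => e.cost + f.cost + 1
  | ltR e f => e.cost + f.cost + 1
  | not b => b.cost + 1
  | and b c => b.cost + c.cost + 1

/-- The evaluation of a test succeeds; in a conjunction the second test is evaluated only if the
first one holds. -/
def Test.Ok (w m : ℕ) (s : State) : Test → Prop
  | eqN e f => e.Ok w m s ∧ f.Ok w m s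
  | ltN e f => e.Ok w m s ∧ f.Ok w m s
  | eqR e f => e.Ok w m s ∧ f.Ok w m s
  | ltR e f => e.Ok w m s ∧ f.Ok w m s
  | not b => b.Ok w m s
  | and b c => b.Ok w m s ∧ (b.Holds s → c.Ok w m s)

/-- Programs. -/
inductive Prog where
  | skip
  | setN (i : ℕ) (e : NExp)
  | setR (i : ℕ) (e : RExp)
  | putN (a : ℕ) (i e : NExp)
  | putR (a : ℕ) (i : NExp) (e : RExp)
  | seq (p q : Prog)
  | branch (b : Test) (p q : Prog)
  | loop (b : Test) (p : Prog)

/-- Overwrite a word register. -/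
def State.setN (s : State) (i v : ℕ) : State :=
  { s with nreg := Function.update s.nreg i v }

/-- Overwrite a real register. -/
def State.setR (s : State) (i : ℕ) (v : ℝ) : State :=
  { s with rreg := Function.update s.rreg i v }

/-- Overwrite a cell of a word array. -/
def State.putN (s : State) (a i v : ℕ) : State :=
  { s with narr := Function.update s.narr a (Function.update (s.narr a) i v) }

/-- Overwrite a cell of a real array. -/
def State.putR (s : State) (a i : ℕ) (v : ℝ) : State :=
  { s with rarr := Function.update s.rarr a (Function.update (s.rarr a) i v) }

/-- `Exec w m p s t s'`: on a machine with words of `w` bits and arrays of `m` cells, the program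
`p` started in `s` halts after exactly `t` steps in `s'`, without overflow, access outside an
array, or division by zero. -/
inductive Exec (w m : ℕ) : Prog → State → ℕ → State → Prop
  | skip (s : State) : Exec w m .skip s 1 s
  | setN (s : State) (i : ℕ) (e : NExp) (h : e.Ok w m s) :
      Exec w m (.setN i e) s (e.cost + 1) (s.setN i (e.val s))
  | setR (s : State) (i : ℕ) (e : RExp) (h : e.Ok w m s) :
      Exec w m (.setR i e) s (e.cost + 1) (s.setR i (e.val s))
  | putN (s : State) (a : ℕ) (i e : NExp) (hi : i.Ok w m s) (hm : i.val s < m)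
      (h : e.Ok w m s) :
      Exec w m (.putN a i e) s (i.cost + e.cost + 1) (s.putN a (i.val s) (e.val s))
  | putR (s : State) (a : ℕ) (i : NExp) (e : RExp) (hi : i.Ok w m s) (hm : i.val s < m)
      (h : e.Ok w m s) :
      Exec w m (.putR a i e) s (i.cost + e.cost + 1) (s.putR a (i.val s) (e.val s))
  | seq {p q : Prog} {s s₁ s₂ : State} {t₁ t₂ : ℕ} (hp : Exec w m p s t₁ s₁)
      (hq : Exec w m q s₁ t₂ s₂) : Exec w m (.seq p q) s (t₁ + t₂) s₂
  | branchTrue {b : Test} {p q : Prog} {s s' : State} {t : ℕ} (hb : b.Ok w m s)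
      (h : b.Holds s) (hp : Exec w m p s t s') :
      Exec w m (.branch b p q) s (b.cost + t + 1) s'
  | branchFalse {b : Test} {p q : Prog} {s s' : State} {t : ℕ} (hb : b.Ok w m s)
      (h : ¬ b.Holds s) (hq : Exec w m q s t s') :
      Exec w m (.branch b p q) s (b.cost + t + 1) s'
  | loopDone {b : Test} {p : Prog} {s : State} (hb : b.Ok w m s) (h : ¬ b.Holds s) :
      Exec w m (.loop b p) s (b.cost + 1) s
  | loopStep {b : Test} {p : Prog} {s s₁ s₂ : State} {t₁ t₂ : ℕ} (hb : b.Ok w m s)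
      (h : b.Holds s) (hp : Exec w m p s t₁ s₁) (hl : Exec w m (.loop b p) s₁ t₂ s₂) :
      Exec w m (.loop b p) s (b.cost + t₁ + t₂ + 1) s₂

end RealRAM

/-- The region `L⁺` swept upwards from the segment `L` with end-points `a`, `b` (`a.1 ≠ b.1`): the
points of the closed vertical strip of `L` lying strictly above the line through `a` and `b`. -/
def aboveSegment (a b : ℝ × ℝ) : Set (ℝ × ℝ) :=
  {q | min a.1 b.1 ≤ q.1 ∧ q.1 ≤ max a.1 b.1 ∧
    a.2 + (b.2 - a.2) / (b.1 - a.1) * (q.1 - a.1) < q.2}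


/-- Start configuration of the preprocessing: `n` in word register 0, the coordinates of the
points in the first `n` cells of the real arrays 0 and 1, and zero everywhere else. -/
noncomputable def inputState {n : ℕ} (p : Fin n → ℝ × ℝ) : RealRAM.State where
  nreg := fun i => if i = 0 then n else 0
  rreg := fun _ => 0
  narr := fun _ _ => 0
  rarr := fun a i =>
    if h : i < n then
      if a = 0 then (p ⟨i, h⟩).1 else if a = 1 then (p ⟨i, h⟩).2 else 0
    else 0

/-- Pose the query with end-points `a`, `b`: their four coordinates are placed in the real
registers 0, 1, 2, 3; everything else is left as it is. -/
noncomputable def poseQuery (s : RealRAM.State) (a b : ℝ × ℝ) : RealRAM.State :=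
  (((s.setR 0 a.1).setR 1 a.2).setR 2 b.1).setR 3 b.2

/-- On a machine with words of `w` bits and arrays of `m` cells, the pair of programs `pre`,
`query` solves the one-sided segment sweeping query problem for the point set
`{p 0, …, p (n - 1)}`: `pre` halts within `tPre` steps, and from then on any sequence of queries,
which need not be known in advance, is answered correctly (in word register 0, with the answer 0
if and only if no point of the set lies above the segment), each of them within `tQuery` steps.
The predicate `Rep` collects the memory configurations that may occur between queries. -/
def SolvesSweeping (w m tPre tQuery : ℕ) (pre query : RealRAM.Prog) {n : ℕ}
    (p : Fin n → ℝ × ℝ) : Prop :=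
  ∃ Rep : RealRAM.State → Prop,
    (∃ t s, RealRAM.Exec w m pre (inputState p) t s ∧ t ≤ tPre ∧ Rep s) ∧
    ∀ s, Rep s → ∀ a b : ℝ × ℝ, a.1 ≠ b.1 →
      ∃ t s', RealRAM.Exec w m query (poseQuery s a b) t s' ∧ t ≤ tQuery ∧ Rep s' ∧
        (s'.nreg 0 = 0 ↔ Set.range p ∩ aboveSegment a b = ∅)

/-! Let `μ` be the slope of the query segment and `c` its intercept. A point of the strip lies above
the line exactly when `Y - μ * X > c`, so a query asks for the maximum of the linear function `Y - μ
* X` over the points in the strip. Once the points are sorted by first coordinate, these points have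
consecutive indices.

The points are padded to `A = 2 ^ K` cells and cut into `2 ^ H` blocks of length `B`, where `K ≤ B ≤
2 * K + 1`. A block is short enough to be scanned point by point. The blocks are the leaves of a
balanced binary tree whose nodes are the aligned segments of blocks. For a segment and a block `k`
in its right half, consider the upper hull of the part of the segment up to `k`. One of its edges,
the bridge, leads from the left half to the right half. By concavity, comparing its slope with `μ`
decides which half contains a maximum (`HullStack.separates`). If the left half wins, the search
continues in the whole left child; otherwise it continues in the part of the right child up to `k`.
Either way the remaining range is again a prefix of a segment, so one stored bridge per level and
block is enough, and a block containing a maximum is reached after at most `H` comparisons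
(`descend_runs`).

The blocks of the strip other than the two end blocks form a suffix of one segment followed by a
prefix of the next (`splitLevel_runs`). Suffixes become prefixes in a second copy of the points,
reflected at the vertical axis and stored in reverse order (`Mirrored.noHit`). The two end blocks
are found by binary search and scanned.

All bridges of a segment come from a single Graham scan of its points, recorded as the scan passes
through the right half (`hullStep_runs`). This is linear time per level, hence `O(n log n)` in
total, as for the merge sort. There are `H` levels of `2 * 2 ^ H` cells, and `H ≤ B` gives `H * (2 *
2 ^ H) ≤ 2 * A`. The storage is thus even linear. -/

namespace RealRAM

/-! ### State updates and frame conditions -/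

section States

variable (s : State) (i j v a : ℕ) (x : ℝ)

@[simp] theorem State.setN_nreg :
    (s.setN i v).nreg j = if j = i then v else s.nreg j := by
  simp [State.setN, Function.update_apply]
@[simp] theorem State.setN_rreg : (s.setN i v).rreg = s.rreg := rfl
@[simp] theorem State.setN_rarr : (s.setN i v).rarr = s.rarr := rfl
@[simp] theorem State.setR_nreg : (s.setR i x).nreg = s.nreg := rfl
@[simp] theorem State.setR_rreg :
    (s.setR i x).rreg j = if j = i then x else s.rreg j := by
  simp [State.setR, Function.update_apply]
@[simp] theorem State.setR_rarr : (s.setR i x).rarr = s.rarr := rfl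
@[simp] theorem State.putR_nreg : (s.putR a i x).nreg = s.nreg := rfl
@[simp] theorem State.putR_rreg : (s.putR a i x).rreg = s.rreg := rfl
@[simp] theorem State.putR_rarr :
    (s.putR a i x).rarr j = if j = a then Function.update (s.rarr a) i x else s.rarr j := by
  simp [State.putR, Function.update_apply]

end States

attribute [simp] NExp.val NExp.Ok RExp.val RExp.Ok Test.Holds Test.Ok

/-- The word registers a program may write to. -/
def Prog.writesN : Prog → List ℕ
  | skip => []
  | setN i _ => [i]
  | setR _ _ => []
  | putN _ _ _ => []
  | putR _ _ _ => []
  | seq p q => p.writesN ++ q.writesN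
  | branch _ p q => p.writesN ++ q.writesN
  | loop _ p => p.writesN

/-- The real registers a program may write to. -/
def Prog.writesR : Prog → List ℕ
  | skip => []
  | setN _ _ => []
  | setR i _ => [i]
  | putN _ _ _ => []
  | putR _ _ _ => []
  | seq p q => p.writesR ++ q.writesR
  | branch _ p q => p.writesR ++ q.writesR
  | loop _ p => p.writesR

/-- The real arrays a program may write to. -/
def Prog.writesA : Prog → List ℕ
  | skip => []
  | setN _ _ => []
  | setR _ _ => []
  | putN _ _ _ => []
  | putR a _ _ => [a]
  | seq p q => p.writesA ++ q.writesA
  | branch _ p q => p.writesA ++ q.writesA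
  | loop _ p => p.writesA

/-- The states differ at most in registers and real arrays that the program writes to. -/
structure Frame (p : Prog) (s s' : State) : Prop where
  n : ∀ i, i ∉ p.writesN → s'.nreg i = s.nreg i
  r : ∀ i, i ∉ p.writesR → s'.rreg i = s.rreg i
  a : ∀ i, i ∉ p.writesA → s'.rarr i = s.rarr i

theorem Frame.refl (p : Prog) (s : State) : Frame p s s :=
  ⟨fun _ _ => rfl, fun _ _ => rfl, fun _ _ => rfl⟩

theorem Frame.trans {p : Prog} {s s' s'' : State} (h : Frame p s s') (h' : Frame p s' s'') :
    Frame p s s'' :=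
  ⟨fun i hi => (h'.n i hi).trans (h.n i hi), fun i hi => (h'.r i hi).trans (h.r i hi),
    fun i hi => (h'.a i hi).trans (h.a i hi)⟩

theorem Frame.weaken {p q : Prog} {s s' : State} (h : Frame p s s')
    (hn : p.writesN ⊆ q.writesN) (hr : p.writesR ⊆ q.writesR) (ha : p.writesA ⊆ q.writesA) :
    Frame q s s' :=
  ⟨fun i hi => h.n i fun c => hi (hn c), fun i hi => h.r i fun c => hi (hr c),
    fun i hi => h.a i fun c => hi (ha c)⟩

/-- Induction on the execution. Since the write sets are computed from the program text, `decide`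
can later show that a given register or array has survived a subprogram. -/
theorem Exec.frame {w m : ℕ} {p : Prog} {s s' : State} {t : ℕ} (h : Exec w m p s t s') :
    Frame p s s' := by
  induction h with
  | skip s => exact .refl _ _
  | setN s i e h =>
    exact ⟨fun j hj => by simp_all [Prog.writesN], fun _ _ => rfl, fun _ _ => rfl⟩
  | setR s i e h =>
    exact ⟨fun _ _ => rfl, fun j hj => by simp_all [Prog.writesR], fun _ _ => rfl⟩
  | putN s a i e hi hm h => exact ⟨fun _ _ => rfl, fun _ _ => rfl, fun _ _ => rfl⟩
  | putR s a i e hi hm h =>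
    exact ⟨fun _ _ => rfl, fun _ _ => rfl, fun j hj => by simp_all [Prog.writesA]⟩
  | seq hp hq ihp ihq =>
    exact (ihp.weaken (by simp [Prog.writesN]) (by simp [Prog.writesR])
      (by simp [Prog.writesA])).trans (ihq.weaken (by simp [Prog.writesN])
      (by simp [Prog.writesR]) (by simp [Prog.writesA]))
  | branchTrue hb h hp ih =>
    exact ih.weaken (by simp [Prog.writesN]) (by simp [Prog.writesR]) (by simp [Prog.writesA])
  | branchFalse hb h hp ih =>
    exact ih.weaken (by simp [Prog.writesN]) (by simp [Prog.writesR]) (by simp [Prog.writesA])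
  | loopDone hb h => exact .refl _ _
  | loopStep hb h hp hl ihp ihl => exact Frame.trans (p := .loop _ _) ⟨ihp.n, ihp.r, ihp.a⟩ ihl

/-! ### Program logic with step bounds -/

/-- Started in `s`, the program halts within `T` steps in a state satisfying `Q`. -/
def Runs (w m : ℕ) (p : Prog) (s : State) (T : ℕ) (Q : State → Prop) : Prop :=
  ∃ t s', Exec w m p s t s' ∧ t ≤ T ∧ Q s'

section Rules

variable {w m : ℕ} {p q : Prog} {s : State} {T T' : ℕ} {Q Q' : State → Prop}

theorem Runs.mono (h : Runs w m p s T Q) (hT : T ≤ T') (hQ : ∀ s', Q s' → Q' s') :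
    Runs w m p s T' Q' := by
  obtain ⟨t, s', h1, h2, h3⟩ := h
  exact ⟨t, s', h1, h2.trans hT, hQ _ h3⟩

theorem Runs.frame (h : Runs w m p s T Q) :
    Runs w m p s T (fun s' => Frame p s s' ∧ Q s') := by
  obtain ⟨t, s', h1, h2, h3⟩ := h
  exact ⟨t, s', h1, h2, h1.frame, h3⟩

theorem Runs.seq (h : Runs w m p s T (fun s₁ => Runs w m q s₁ T' Q)) :
    Runs w m (.seq p q) s (T + T') Q := by
  obtain ⟨t, s', h1, h2, t', s'', h3, h4, h5⟩ := h
  exact ⟨t + t', s'', .seq h1 h3, by omega, h5⟩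

theorem Runs.branch {b : Test} (hb : b.Ok w m s) (hp : b.Holds s → Runs w m p s T Q)
    (hq : ¬ b.Holds s → Runs w m q s T Q) :
    Runs w m (.branch b p q) s (b.cost + T + 1) Q := by
  by_cases h : b.Holds s
  · obtain ⟨t, s', h1, h2, h3⟩ := hp h
    exact ⟨_, s', .branchTrue hb h h1, by omega, h3⟩
  · obtain ⟨t, s', h1, h2, h3⟩ := hq h
    exact ⟨_, s', .branchFalse hb h h1, by omega, h3⟩

/-- A loop with invariant `I` and variant `v`. -/
theorem Runs.loop {b : Test} {I : State → Prop} {v : State → ℕ} {C V : ℕ} {s₀ : State}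
    (hI : I s₀) (hV : v s₀ ≤ V)
    (hb : ∀ s, Frame p s₀ s → I s → b.Ok w m s ∧
      (b.Holds s → Runs w m p s C (fun s' => I s' ∧ v s' < v s))) :
    Runs w m (.loop b p) s₀ (V * (b.cost + C + 1) + b.cost + 1)
      (fun s' => Frame p s₀ s' ∧ I s' ∧ ¬ b.Holds s') := by
  -- The current state is generalised while the frame stays anchored at the initial state `s₀`, so
  -- that invariants need not mention what the body never writes.
  suffices H : ∀ V s, Frame p s₀ s → I s → v s ≤ V →
      Runs w m (.loop b p) s (V * (b.cost + C + 1) + b.cost + 1)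
        (fun s' => Frame p s₀ s' ∧ I s' ∧ ¬ b.Holds s') from H V s₀ (.refl _ _) hI hV
  intro V
  induction V with
  | zero =>
    intro s hf hs hv
    obtain ⟨hok, hstep⟩ := hb s hf hs
    by_cases h : b.Holds s
    · obtain ⟨t, s', h1, h2, h3, h4⟩ := hstep h
      omega
    · exact ⟨_, s, .loopDone hok h, by omega, hf, hs, h⟩
  | succ V ih =>
    intro s hf hs hv
    obtain ⟨hok, hstep⟩ := hb s hf hs
    by_cases h : b.Holds s
    · obtain ⟨t, s', h1, h2, h3, h4⟩ := hstep h
      obtain ⟨t', s'', h5, h6, h7⟩ := ih s' (hf.trans h1.frame) h3 (by omega)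
      exact ⟨_, s'', .loopStep hok h h1 h5, by rw [Nat.succ_mul]; omega, h7⟩
    · exact ⟨_, s, .loopDone hok h, by rw [Nat.succ_mul]; omega, hf, hs, h⟩

end Rules

/-- Weakest precondition of a program without loops. -/
@[simp] def Prog.wp (w m : ℕ) : Prog → State → (State → Prop) → Prop
  | skip, s, Q => Q s
  | setN i e, s, Q => e.Ok w m s ∧ Q (s.setN i (e.val s))
  | setR i e, s, Q => e.Ok w m s ∧ Q (s.setR i (e.val s))
  | putN a i e, s, Q => i.Ok w m s ∧ i.val s < m ∧ e.Ok w m s ∧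
      Q (s.putN a (i.val s) (e.val s))
  | putR a i e, s, Q => i.Ok w m s ∧ i.val s < m ∧ e.Ok w m s ∧
      Q (s.putR a (i.val s) (e.val s))
  | seq p q, s, Q => p.wp w m s fun s₁ => q.wp w m s₁ Q
  | branch b p q, s, Q => b.Ok w m s ∧ (b.Holds s → p.wp w m s Q) ∧
      (¬ b.Holds s → q.wp w m s Q)
  | loop _ _, _, _ => False

/-- Worst-case number of steps of a program without loops. -/
def Prog.time : Prog → ℕ
  | skip => 1
  | setN _ e => e.cost + 1
  | setR _ e => e.cost + 1
  | putN _ i e => i.cost + e.cost + 1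
  | putR _ i e => i.cost + e.cost + 1
  | seq p q => p.time + q.time
  | branch b p q => b.cost + max p.time q.time + 1
  | loop _ _ => 0

/-- Reduces loop-free code to a proposition that `simp` can unfold; the time bound is then a closed
numerical inequality. -/
theorem Runs.of_wp {w m : ℕ} {p : Prog} {s : State} {T : ℕ} {Q : State → Prop}
    (h : p.wp w m s Q) (hT : p.time ≤ T) : Runs w m p s T Q := by
  refine Runs.mono (T := p.time) (Q := Q) ?_ hT fun _ h => h
  clear hT
  induction p generalizing s Q with
  | skip => exact ⟨_, _, .skip s, le_rfl, h⟩
  | setN i e => exact ⟨_, _, .setN s i e h.1, le_rfl, h.2⟩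
  | setR i e => exact ⟨_, _, .setR s i e h.1, le_rfl, h.2⟩
  | putN a i e => exact ⟨_, _, .putN s a i e h.1 h.2.1 h.2.2.1, le_rfl, h.2.2.2⟩
  | putR a i e => exact ⟨_, _, .putR s a i e h.1 h.2.1 h.2.2.1, le_rfl, h.2.2.2⟩
  | seq p q ihp ihq => exact Runs.seq ((ihp h).mono le_rfl fun s' h' => ihq h')
  | branch b p q ihp ihq =>
    exact Runs.branch h.1 (fun hb => (ihp (h.2.1 hb)).mono (le_max_left _ _) fun _ h => h)
      (fun hb => (ihq (h.2.2 hb)).mono (le_max_right _ _) fun _ h => h)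
  | loop b p => exact h.elim

/-! ### Upper hulls and bridges -/

/-- The vector `(dx, dy)` tells for every slope `μ` whether `Y - μ * X` is maximized on the index
interval `[s, e)` in its left part `[s, mid)` or in its right part `[mid, e)`. -/
def Separates (X Y : ℕ → ℝ) (s mid e : ℕ) (dx dy : ℝ) : Prop :=
  ∀ μ : ℝ,
    (dy ≤ μ * dx → ∀ q, mid ≤ q → q < e → ∃ p, s ≤ p ∧ p < mid ∧ Y q - μ * X q ≤ Y p - μ * X p) ∧
    (μ * dx < dy → ∀ p, s ≤ p → p < mid → ∃ q, mid ≤ q ∧ q < e ∧ Y p - μ * X p ≤ Y q - μ * X q)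

/-- Along a hull the objective is unimodal: after one non-increase it never rises again. -/
theorem le_of_concave_of_le {f : ℕ → ℝ} {n j : ℕ}
    (hf : ∀ i, i + 2 < n → f (i + 1) ≤ f i → f (i + 2) ≤ f (i + 1)) (h : f (j + 1) ≤ f j) :
    ∀ i, j ≤ i → i < n → f i ≤ f j := by
  have key : ∀ d, j + d + 1 < n → f (j + d + 1) ≤ f (j + d) := by
    intro d
    induction d with
    | zero => exact fun _ => h
    | succ d ih => exact fun hd => hf (j + d) hd (ih (by omega))
  have : ∀ d, j + d < n → f (j + d) ≤ f j := by
    intro d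
    induction d with
    | zero => exact fun _ => le_rfl
    | succ d ih => exact fun hd => (key d hd).trans (ih (by omega))
  intro i hi hin
  obtain ⟨d, rfl⟩ := Nat.exists_eq_add_of_le hi
  exact this d hin

/-- The contrapositive of unimodality, propagated to the left: a strict rise at `j` forces strict
rises at all earlier places. -/
theorem le_of_concave_of_lt {f : ℕ → ℝ} {n j : ℕ}
    (hf : ∀ i, i + 2 < n → f (i + 1) ≤ f i → f (i + 2) ≤ f (i + 1)) (hj : j + 1 < n)
    (h : f j < f (j + 1)) : ∀ i, i ≤ j + 1 → f i ≤ f (j + 1) := by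
  induction j with
  | zero =>
    intro i hi
    obtain rfl | rfl : i = 0 ∨ i = 1 := by omega
    exacts [h.le, le_rfl]
  | succ j ih =>
    have h' : f j < f (j + 1) := by
      by_contra hc
      exact absurd (hf j hj (not_lt.1 hc)) (not_le.2 h)
    intro i hi
    rcases Nat.lt_or_ge i (j + 2) with hlt | hge
    · exact (ih (by omega) h' i (by omega)).trans h.le
    · obtain rfl : i = j + 1 + 1 := by omega
      exact le_rfl

/-- The point `(x₂, y₂)` stays on the upper hull between `(x₁, y₁)` and `(x₃, y₃)`. -/
def KeepsTop (x₁ y₁ x₂ y₂ x₃ y₃ : ℝ) : Prop :=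
  (y₃ - y₂) * (x₂ - x₁) < (y₂ - y₁) * (x₃ - x₂) ∨ (x₂ = x₃ ∧ y₃ < y₂)

/-- A strict right turn means that slopes decrease, so a slope at most `μ` is followed by another
one. The second alternative of `KeepsTop` is needed when all three points are on one vertical line,
where the turn test degenerates to `0 < 0`. -/
theorem KeepsTop.concave {x₁ y₁ x₂ y₂ x₃ y₃ : ℝ} (h : KeepsTop x₁ y₁ x₂ y₂ x₃ y₃) (h₁ : x₁ ≤ x₂)
    (h₂ : x₂ ≤ x₃) (μ : ℝ) (hμ : y₂ - μ * x₂ ≤ y₁ - μ * x₁) : y₃ - μ * x₃ ≤ y₂ - μ * x₂ := by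
  rcases h with h | ⟨rfl, h⟩
  · rcases h₁.eq_or_lt with rfl | h₁
    · have : y₂ ≤ y₁ := by linarith
      nlinarith
    · have h3 : (y₂ - y₁) * (x₃ - x₂) ≤ μ * (x₂ - x₁) * (x₃ - x₂) :=
        mul_le_mul_of_nonneg_right (by linarith) (by linarith)
      have h4 : (y₃ - y₂) * (x₂ - x₁) < (μ * (x₃ - x₂)) * (x₂ - x₁) := by linarith
      have := lt_of_mul_lt_mul_right h4 (by linarith)
      linarith
  · linarith

/-- Without a right turn the middle point is on or below the chord of its neighbours, so no linear
objective prefers it to both. This justifies discarding it. -/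
theorem le_or_le_of_not_keepsTop {x₁ y₁ x₂ y₂ x₃ y₃ : ℝ} (h : ¬ KeepsTop x₁ y₁ x₂ y₂ x₃ y₃)
    (h₁ : x₁ ≤ x₂) (h₂ : x₂ ≤ x₃) (μ : ℝ) :
    y₂ - μ * x₂ ≤ y₁ - μ * x₁ ∨ y₂ - μ * x₂ ≤ y₃ - μ * x₃ := by
  rw [KeepsTop, not_or, not_lt, not_and, not_lt] at h
  obtain ⟨h, ht⟩ := h
  rcases h₂.eq_or_lt with rfl | h₂
  · right
    linarith [ht rfl]
  · by_contra! hc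
    obtain ⟨hc₁, hc₂⟩ := hc
    rcases h₁.eq_or_lt with rfl | h₁
    · have : 0 < y₂ - y₁ := by linarith
      nlinarith [mul_pos this (sub_pos.2 h₂)]
    · have h3 : μ * (x₂ - x₁) * (x₃ - x₂) < (y₂ - y₁) * (x₃ - x₂) :=
        mul_lt_mul_of_pos_right (by linarith) (by linarith)
      have h4 : (y₃ - y₂) * (x₂ - x₁) < (μ * (x₃ - x₂)) * (x₂ - x₁) :=
        mul_lt_mul_of_pos_right (by linarith) (by linarith)
      linarith

/-- The stack `SX, SY` of height `sz` together with the point of index `t` spans the upper hull of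
the points with indices in `[s, t]`; the entries below `lc` have indices below `mid`. -/
structure HullStack (X Y : ℕ → ℝ) (s mid t : ℕ) (SX SY : ℕ → ℝ) (sz lc : ℕ) : Prop where
  size : s + sz ≤ t
  pos : s < t → 1 ≤ sz
  lc_pos : s < t → 1 ≤ lc
  mem : ∀ i, i < sz → ∃ u, s ≤ u ∧ u < t ∧ SX i = X u ∧ SY i = Y u ∧ (i < lc ↔ u < mid)
  mono : ∀ i, i + 1 < sz → SX i ≤ SX (i + 1)
  concave : ∀ i, i + 2 < sz → ∀ μ, SY (i + 1) - μ * SX (i + 1) ≤ SY i - μ * SX i →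
    SY (i + 2) - μ * SX (i + 2) ≤ SY (i + 1) - μ * SX (i + 1)
  dom : ∀ u, s ≤ u → u < t → ∀ μ, (∃ i, i < sz ∧ Y u - μ * X u ≤ SY i - μ * SX i) ∨
    Y u - μ * X u ≤ Y t - μ * X t

namespace HullStack

variable {X Y SX SY : ℕ → ℝ} {s mid t e sz lc : ℕ}

theorem init (X Y SX SY : ℕ → ℝ) (s mid lc : ℕ) : HullStack X Y s mid s SX SY 0 lc where
  size := by omega
  pos := by omega
  lc_pos := by omega
  mem := by omega
  mono := by omega
  concave := by omega
  dom := by omega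

theorem le_next (h : HullStack X Y s mid t SX SY sz lc) (hte : t < e)
    (hX : ∀ u v, s ≤ u → u ≤ v → v < e → X u ≤ X v) {i : ℕ} (hi : i < sz) : SX i ≤ X t := by
  obtain ⟨u, h1, h2, h3, -⟩ := h.mem i hi
  exact h3 ▸ hX u t h1 h2.le hte

/-- Whatever the discarded entry dominated is now dominated by the entry below it or by the pending
point `t`; the last alternative of `dom` exists for this purpose. -/
theorem pop (h : HullStack X Y s mid t SX SY (sz + 2) lc) (hte : t < e)
    (hX : ∀ u v, s ≤ u → u ≤ v → v < e → X u ≤ X v)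
    (hk : ¬ KeepsTop (SX sz) (SY sz) (SX (sz + 1)) (SY (sz + 1)) (X t) (Y t)) :
    HullStack X Y s mid t SX SY (sz + 1) lc where
  size := by have := h.size; omega
  pos := by omega
  lc_pos := h.lc_pos
  mem i hi := h.mem i (by omega)
  mono i hi := h.mono i (by omega)
  concave i hi := h.concave i (by omega)
  dom u hu hut μ := by
    rcases h.dom u hu hut μ with ⟨i, hi, hle⟩ | hle
    · rcases Nat.lt_or_ge i (sz + 1) with hlt | hge
      · exact .inl ⟨i, hlt, hle⟩
      · obtain rfl : i = sz + 1 := by omega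
        rcases le_or_le_of_not_keepsTop hk (h.mono sz (by omega))
          (h.le_next hte hX (by omega)) μ with h' | h'
        · exact .inl ⟨sz, by omega, hle.trans h'⟩
        · exact .inr (hle.trans h')
    · exact .inr hle

theorem push_dom (h : HullStack X Y s mid t SX SY sz lc) {u : ℕ} (hu : s ≤ u) (hut : u < t + 1)
    (μ : ℝ) : ∃ i, i < sz + 1 ∧ Y u - μ * X u ≤
      Function.update SY sz (Y t) i - μ * Function.update SX sz (X t) i := by
  rcases Nat.lt_succ_iff_lt_or_eq.1 hut with hut | rfl
  · rcases h.dom u hu hut μ with ⟨i, hi, hle⟩ | hle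
    · exact ⟨i, by omega, by simpa [hi.ne] using hle⟩
    · exact ⟨sz, by omega, by simpa using hle⟩
  · exact ⟨sz, by omega, by simp⟩

/-- Pops do not update `lc`, so it may exceed the stack height. Taking `min lc sz` when a point of
the right half arrives makes it the number of entries from the left half again. It stays positive
because the bottom entry is never popped. -/
theorem push (h : HullStack X Y s mid t SX SY sz lc) (hst : s ≤ t) (hte : t < e)
    (hX : ∀ u v, s ≤ u → u ≤ v → v < e → X u ≤ X v)
    (hk : ∀ i, i + 2 = sz → KeepsTop (SX i) (SY i) (SX (i + 1)) (SY (i + 1)) (X t) (Y t))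
    {lc' : ℕ} (hlc : (t < mid ∧ lc' = sz + 1) ∨ (mid ≤ t ∧ s < t ∧ lc' = min lc sz)) :
    HullStack X Y s mid (t + 1) (Function.update SX sz (X t)) (Function.update SY sz (Y t))
      (sz + 1) lc' where
  size := by have := h.size; omega
  pos := by omega
  lc_pos := by
    intro _
    rcases hlc with ⟨_, rfl⟩ | ⟨_, h2, rfl⟩
    · omega
    · have := h.pos h2
      have := h.lc_pos h2
      omega
  mem i hi := by
    rcases Nat.lt_succ_iff_lt_or_eq.1 hi with hi | rfl
    · obtain ⟨u, h1, h2, h3, h4, h5⟩ := h.mem i hi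
      refine ⟨u, h1, by omega, by simp [hi.ne, h3], by simp [hi.ne, h4], ?_⟩
      omega
    · exact ⟨t, hst, by omega, by simp, by simp, by omega⟩
  mono i hi := by
    rcases Nat.lt_succ_iff_lt_or_eq.1 hi with hi | hi
    · simpa [hi.ne, show i ≠ sz by omega] using h.mono i hi
    · simpa [hi, show i ≠ sz by omega] using h.le_next hte hX (show i < sz by omega)
  concave i hi μ := by
    rcases Nat.lt_succ_iff_lt_or_eq.1 hi with hi | hi
    · simpa [hi.ne, show i ≠ sz by omega, show i + 1 ≠ sz by omega] using h.concave i hi μ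
    · subst hi
      simpa using (hk i rfl).concave (h.mono i (by omega)) (h.le_next hte hX (by omega)) μ

  dom u hu hut μ := .inl (h.push_dom hu hut μ)

/-- Entries `lc - 1` and `lc` are the two ends of the bridge. If the objective does not rise along
the bridge, unimodality puts every right entry at or below the left end; if it rises, every left
entry is below the right end. Using the edge vector instead of its slope also allows vertical
bridges. -/
theorem separates (h : HullStack X Y s mid t SX SY sz lc) (hs : s < t) (hlc : lc < sz)
    (hdom : ∀ u, s ≤ u → u < t → ∀ μ, ∃ i, i < sz ∧ Y u - μ * X u ≤ SY i - μ * SX i) :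
    Separates X Y s mid t (SX lc - SX (lc - 1)) (SY lc - SY (lc - 1)) := by
  obtain ⟨l, rfl⟩ : ∃ l, lc = l + 1 := ⟨lc - 1, by have := h.lc_pos hs; omega⟩
  simp only [Nat.add_sub_cancel]
  intro μ
  have hf := fun i hi => h.concave i hi μ
  constructor
  · intro hμ q hq hqt
    obtain ⟨i, hi, hle⟩ := hdom q (by obtain ⟨u, _, _, _, _, _⟩ := h.mem l (by omega); omega) hqt μ
    obtain ⟨j, hj, hle'⟩ : ∃ j, j < l + 1 ∧ SY i - μ * SX i ≤ SY j - μ * SX j := by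
      rcases Nat.lt_or_ge i (l + 1) with h1 | h1
      · exact ⟨i, h1, le_rfl⟩
      · exact ⟨l, by omega, le_of_concave_of_le (f := fun i => SY i - μ * SX i) hf
          (by linarith) i (by omega) hi⟩
    obtain ⟨u, h1, h2, h3, h4, h5⟩ := h.mem j (by omega)
    exact ⟨u, h1, h5.1 hj, by rw [← h3, ← h4]; exact hle.trans hle'⟩
  · intro hμ p hp hpm
    obtain ⟨u, h1, h2, h3, h4, h5⟩ := h.mem (l + 1) hlc
    obtain ⟨i, hi, hle⟩ := hdom p hp (by omega) μ
    obtain ⟨j, hj, hjs, hle'⟩ : ∃ j, l + 1 ≤ j ∧ j < sz ∧ SY i - μ * SX i ≤ SY j - μ * SX j := by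
      rcases Nat.lt_or_ge i (l + 1) with h1 | h1
      · exact ⟨l + 1, le_rfl, hlc, le_of_concave_of_lt (f := fun i => SY i - μ * SX i) hf hlc
          (by linarith) i (by omega)⟩
      · exact ⟨i, h1, hi, le_rfl⟩
    obtain ⟨u, h1, h2, h3, h4, h5⟩ := h.mem j hjs
    exact ⟨u, by omega, h2, by rw [← h3, ← h4]; exact hle.trans hle'⟩

end HullStack

/-! ### Merging sorted intervals -/

/-- The state of a merge of the sorted index intervals `[s, s + l)` and `[s + l, s + 2 * l)`:
`i` and `j` are the next elements of the two intervals, `o` is the next free cell. -/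
structure Merging (X Y DX DY : ℕ → ℝ) (s l i j o : ℕ) : Prop where
  left : s ≤ i ∧ i ≤ s + l
  right : s + l ≤ j ∧ j ≤ s + 2 * l
  out : o + (s + l) = i + j
  sorted : ∀ u v, s ≤ u → u ≤ v → v < o → DX u ≤ DX v
  below_left : ∀ u v, s ≤ u → u < o → i ≤ v → v < s + l → DX u ≤ X v
  below_right : ∀ u v, s ≤ u → u < o → j ≤ v → v < s + 2 * l → DX u ≤ X v
  mem : ∀ u, s ≤ u → u < o → ∃ v, s ≤ v ∧ v < s + 2 * l ∧ DX u = X v ∧ DY u = Y v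
  mem_left : ∀ v, s ≤ v → v < i → ∃ u, s ≤ u ∧ u < o ∧ DX u = X v ∧ DY u = Y v
  mem_right : ∀ v, s + l ≤ v → v < j → ∃ u, s ≤ u ∧ u < o ∧ DX u = X v ∧ DY u = Y v

namespace Merging

variable {X Y DX DY : ℕ → ℝ} {s l i j o : ℕ}

theorem init (X Y DX DY : ℕ → ℝ) (s l : ℕ) : Merging X Y DX DY s l s (s + l) s where
  left := by omega
  right := by omega
  out := by omega
  sorted := by omega
  below_left := by omega
  below_right := by omega
  mem := by omega
  mem_left := by omega
  mem_right := by omega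

/-- Treats both sources at once: `k` is the index of the moved element. Its minimality among all
elements not yet moved, `hl` and `hr`, keeps the output sorted and below the rest. -/
theorem take (h : Merging X Y DX DY s l i j o) {k i' j' : ℕ} (hk : s ≤ k ∧ k < s + 2 * l)
    (hij : (k = i ∧ i < s + l ∧ i' = i + 1 ∧ j' = j) ∨
      (k = j ∧ j < s + 2 * l ∧ i' = i ∧ j' = j + 1))
    (hl : ∀ v, i ≤ v → v < s + l → X k ≤ X v)
    (hr : ∀ v, j ≤ v → v < s + 2 * l → X k ≤ X v) :
    Merging X Y (Function.update DX o (X k)) (Function.update DY o (Y k)) s l i' j' (o + 1) where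
  left := by have := h.left; omega
  right := by have := h.right; omega
  out := by have := h.out; omega
  sorted u v hu huv hv := by
    have := h.left; have := h.right
    rcases Nat.lt_succ_iff_lt_or_eq.1 hv with hv | rfl
    · simpa [hv.ne, (huv.trans_lt hv).ne] using h.sorted u v hu huv hv
    · rcases huv.eq_or_lt with rfl | huv
      · simp
      · rcases hij with ⟨rfl, h1, h2, h3⟩ | ⟨rfl, h1, h2, h3⟩
        · simpa [huv.ne] using h.below_left u k hu huv le_rfl h1
        · simpa [huv.ne] using h.below_right u k hu huv le_rfl h1
  below_left u v hu huo hv hvl := by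
    rcases Nat.lt_succ_iff_lt_or_eq.1 huo with huo | rfl
    · simpa [huo.ne] using h.below_left u v hu huo (by omega) hvl
    · simpa using hl v (by omega) hvl
  below_right u v hu huo hv hvl := by
    rcases Nat.lt_succ_iff_lt_or_eq.1 huo with huo | rfl
    · simpa [huo.ne] using h.below_right u v hu huo (by omega) hvl
    · simpa using hr v (by omega) hvl
  mem u hu huo := by
    rcases Nat.lt_succ_iff_lt_or_eq.1 huo with huo | rfl
    · simpa [huo.ne] using h.mem u hu huo
    · exact ⟨k, hk.1, hk.2, by simp, by simp⟩
  mem_left v hv hvi := by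
    have := h.left; have := h.right; have := h.out
    by_cases hvk : v = k
    · exact ⟨o, by omega, by omega, by simp [hvk], by simp [hvk]⟩
    · obtain ⟨u, h1, h2, h3⟩ := h.mem_left v hv (by omega)
      exact ⟨u, h1, by omega, by simpa [h2.ne] using h3⟩
  mem_right v hv hvi := by
    have := h.left; have := h.right; have := h.out
    by_cases hvk : v = k
    · exact ⟨o, by omega, by omega, by simp [hvk], by simp [hvk]⟩
    · obtain ⟨u, h1, h2, h3⟩ := h.mem_right v hv (by omega)
      exact ⟨u, h1, by omega, by simpa [h2.ne] using h3⟩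

end Merging

/-- The index of the next element to be merged comes from the left interval. -/
def takesLeft : Test :=
  .and (.ltN (.reg 10) (.add (.reg 9) (.reg 8)))
    (.not (.and (.ltN (.reg 11) (.add (.reg 9) (.mul (.const 2) (.reg 8))))
      (.ltR (.get 0 (.reg 11)) (.get 0 (.reg 10)))))

/-- Move one element. -/
def mergeStep : Prog :=
  .seq (.branch takesLeft
    (.seq (.putR 2 (.reg 12) (.get 0 (.reg 10))) <|
      .seq (.putR 3 (.reg 12) (.get 1 (.reg 10))) <| .setN 10 (.add (.reg 10) (.const 1)))
    (.seq (.putR 2 (.reg 12) (.get 0 (.reg 11))) <|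
      .seq (.putR 3 (.reg 12) (.get 1 (.reg 11))) <| .setN 11 (.add (.reg 11) (.const 1))))
    (.setN 12 (.add (.reg 12) (.const 1)))

/-- Merge two neighbouring intervals, of length in register 8 and with start in register 9, of the
arrays 0, 1 into the arrays 2, 3. -/
def merge : Prog :=
  .seq (.setN 10 (.reg 9)) <| .seq (.setN 11 (.add (.reg 9) (.reg 8))) <|
  .seq (.setN 12 (.reg 9)) <|
  .loop (.ltN (.reg 12) (.add (.reg 9) (.mul (.const 2) (.reg 8)))) mergeStep

theorem word_ne_zero {w a : ℕ} (h : a + 8 < 2 ^ w) : w ≠ 0 := by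
  rintro rfl
  omega

variable {w m : ℕ}

theorem merge_runs {A l g : ℕ} {s : State} (hw : 4 * A + 8 < 2 ^ w) (hm : 2 * A + 1 < m)
    (h8 : s.nreg 8 = l) (h9 : s.nreg 9 = g) (hA : g + 2 * l ≤ A)
    (hs : ∀ u v, g ≤ u → u ≤ v → v < g + l → s.rarr 0 u ≤ s.rarr 0 v)
    (hs' : ∀ u v, g + l ≤ u → u ≤ v → v < g + 2 * l → s.rarr 0 u ≤ s.rarr 0 v) :
    Runs w m merge s (2 * l * 80 + 40) fun s' => Frame merge s s' ∧
      Merging (s.rarr 0) (s.rarr 1) (s'.rarr 2) (s'.rarr 3) g l (g + l) (g + 2 * l)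
        (g + 2 * l) ∧
      (∀ u, u < g → s'.rarr 2 u = s.rarr 2 u ∧ s'.rarr 3 u = s.rarr 3 u) := by
  have hw0 := word_ne_zero hw
  refine Runs.frame ?_
  unfold merge
  refine Runs.mono (T := 4 + (4 + (4 + (2 * l * 80 + 20)))) ?_ (by omega) (fun _ h => h)
  refine Runs.seq (Runs.of_wp ⟨by simp; omega, ?_⟩ (by decide))
  refine Runs.seq (Runs.of_wp ⟨by simp [*]; omega, ?_⟩ (by decide))
  refine Runs.seq (Runs.of_wp ⟨by simp [*]; omega, ?_⟩ (by decide))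
  refine (Runs.loop (I := fun s' => s'.nreg 10 ≤ A ∧ s'.nreg 11 ≤ A ∧ s'.nreg 12 ≤ A ∧
      Merging (s.rarr 0) (s.rarr 1) (s'.rarr 2) (s'.rarr 3) g l
      (s'.nreg 10) (s'.nreg 11) (s'.nreg 12) ∧
      (∀ u, u < g → s'.rarr 2 u = s.rarr 2 u ∧ s'.rarr 3 u = s.rarr 3 u))
      (v := fun s' => g + 2 * l - s'.nreg 12) (V := 2 * l) (C := 60) ?_ ?_ ?_).mono ?_ ?_
  · simp [h8, h9]
    refine ⟨by omega, by omega, by omega, Merging.init _ _ _ _ _ _⟩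
  · simp [h9]
  · rintro s₁ hf ⟨b1, b2, b3, hM, hsame⟩
    have e8 : s₁.nreg 8 = l := by rw [hf.n 8 (by decide)]; simp [h8]
    have e9 : s₁.nreg 9 = g := by rw [hf.n 9 (by decide)]; simp [h9]
    have e0 : s₁.rarr 0 = s.rarr 0 := by rw [hf.a 0 (by decide)]; simp
    have e1 : s₁.rarr 1 = s.rarr 1 := by rw [hf.a 1 (by decide)]; simp
    have := hM.left; have := hM.right; have := hM.out
    refine ⟨by simp [*]; omega, fun hlt => Runs.of_wp ?_ (by decide)⟩
    simp [e8, e9] at hlt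
    have key : ∀ k i' j', ((k = s₁.nreg 10 ∧ k < g + l ∧ i' = k + 1 ∧ j' = s₁.nreg 11 ∧
        (s₁.nreg 11 < g + 2 * l → s.rarr 0 k ≤ s.rarr 0 (s₁.nreg 11)))
        ∨ (k = s₁.nreg 11 ∧ k < g + 2 * l ∧ i' = s₁.nreg 10 ∧ j' = k + 1 ∧
        (s₁.nreg 10 < g + l → s.rarr 0 k ≤ s.rarr 0 (s₁.nreg 10)))) →
        Merging (s.rarr 0) (s.rarr 1) (Function.update (s₁.rarr 2) (s₁.nreg 12) (s.rarr 0 k))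
          (Function.update (s₁.rarr 3) (s₁.nreg 12) (s.rarr 1 k)) g l i' j' (s₁.nreg 12 + 1) := by
      rintro k i' j' hk
      refine hM.take (by omega) (by omega) (fun v h1 h2 => ?_) (fun v h1 h2 => ?_)
      · rcases hk with ⟨rfl, h3, h4, h5, h6⟩ | ⟨rfl, h3, h4, h5, h6⟩
        · exact hs _ _ (by omega) h1 h2
        · exact (h6 (by omega)).trans (hs _ _ (by omega) h1 h2)
      · rcases hk with ⟨rfl, h3, h4, h5, h6⟩ | ⟨rfl, h3, h4, h5, h6⟩
        · exact (h6 (by omega)).trans (hs' _ _ (by omega) h1 h2)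
        · exact hs' _ _ (by omega) h1 h2
    have hup : ∀ (f : ℕ → ℝ) x u, u < g → Function.update f (s₁.nreg 12) x u = f u :=
      fun f x u hu => by simp [show u ≠ s₁.nreg 12 by omega]
    simp [mergeStep, takesLeft, e8, e9, e0, e1, hw0]
    refine ⟨by omega, ?_, ?_⟩
    · intro h1 h2
      and_intros <;> try omega
      · exact key _ _ _ (.inl ⟨rfl, h1, rfl, rfl, h2⟩)
      · intro u hu
        simpa [hup _ _ u hu] using hsame u hu
    · intro h1
      and_intros <;> try omega
      · exact key _ _ _ (.inr ⟨rfl, by omega, rfl, rfl, fun h => ((h1 h).2).le⟩)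
      · intro u hu
        simpa [hup _ _ u hu] using hsame u hu
  · simp [Test.cost, NExp.cost]; omega
  · rintro s' ⟨hf, ⟨b1, b2, b3, hM, hsame⟩, hlt⟩
    have e8 : s'.nreg 8 = l := by rw [hf.n 8 (by decide)]; simp [h8]
    have e9 : s'.nreg 9 = g := by rw [hf.n 9 (by decide)]; simp [h9]
    simp [e8, e9] at hlt
    have := hM.left; have := hM.right; have := hM.out
    refine ⟨?_, hsame⟩
    convert hM using 1 <;> omega

/-! ### Block sizes and padding -/

/-- Compute the sizes of the data structure for `n` points, `n` in word register 0: the number `A`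
of cells (a power of two, in register 2), its logarithm (register 1), the block length (register 3),
the number of blocks of two mirrored copies (register 4) and the number of levels (register 5). -/
def computeSizes : Prog :=
  .seq (.setN 6 (.reg 0)) <| .seq (.setN 1 (.const 0)) <| .seq (.setN 2 (.const 1)) <|
  .seq (.loop (.ltN (.reg 2) (.reg 0))
    (.seq (.setN 1 (.add (.reg 1) (.const 1))) (.setN 2 (.mul (.reg 2) (.const 2))))) <|
  .seq (.setN 3 (.const 1)) <| .seq (.setN 5 (.reg 1)) <|
  .seq (.loop (.ltN (.reg 3) (.reg 1))
    (.seq (.setN 3 (.mul (.reg 3) (.const 2))) (.setN 5 (.sub (.reg 5) (.const 1))))) <|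
  .setN 4 (.div (.mul (.const 2) (.reg 2)) (.reg 3))

theorem computeSizes_runs {n K : ℕ} {s : State} (hw : 4 * 2 ^ K + 8 < 2 ^ w)
    (hK : K = Nat.clog 2 n) (h0 : s.nreg 0 = n) :
    Runs w m computeSizes s (K * 40 + 60) fun s' => Frame computeSizes s s' ∧
      ∃ b, b ≤ K ∧ K ≤ 2 ^ b ∧ 2 ^ b ≤ 2 * K + 1 ∧ s'.nreg 1 = K ∧ s'.nreg 2 = 2 ^ K ∧
      s'.nreg 3 = 2 ^ b ∧ s'.nreg 4 = 2 * 2 ^ (K - b) ∧ s'.nreg 5 = K - b ∧ s'.nreg 6 = n := by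
  have hw0 := word_ne_zero hw
  have hn : n ≤ 2 ^ K := hK ▸ Nat.le_pow_clog (by norm_num) n
  have hKlt : K < 2 ^ K := Nat.lt_two_pow_self
  refine Runs.frame ?_
  unfold computeSizes
  refine Runs.mono (T := 2 + (2 + (2 + (K * 20 + 10 + (2 + (2 + (K * 20 + 10 + 10))))))) ?_
    (by omega) (fun _ h => h)
  refine Runs.seq (Runs.of_wp ⟨by simp; omega, ?_⟩ (by decide))
  refine Runs.seq (Runs.of_wp ⟨by simp, ?_⟩ (by decide))
  refine Runs.seq (Runs.of_wp ⟨by simp [hw0], ?_⟩ (by decide))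
  refine Runs.seq ((Runs.loop (I := fun s' => s'.nreg 1 ≤ K ∧ s'.nreg 2 = 2 ^ s'.nreg 1)
      (v := fun s' => K - s'.nreg 1) (V := K) (C := 12) ?_ ?_ ?_).mono ?_ ?_)
  · simp
  · simp
  · rintro s₁ hf ⟨h1, h2⟩
    have e0 : s₁.nreg 0 = n := by rw [hf.n 0 (by decide)]; simp [h0]
    have hle : 2 ^ s₁.nreg 1 ≤ 2 ^ K := Nat.pow_le_pow_right (by norm_num) h1
    refine ⟨by simp [*]; omega, fun hlt => Runs.of_wp ?_ (by decide)⟩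
    simp [e0, h2] at hlt
    have hlt' : s₁.nreg 1 < K := by
      rw [hK]; exact (Nat.lt_clog_iff_pow_lt (by norm_num)).2 hlt
    have : 2 ^ (s₁.nreg 1 + 1) = 2 ^ s₁.nreg 1 * 2 := pow_succ _ _
    simp [h2, hw0]
    and_intros <;> omega
  · simp [Test.cost, NExp.cost]; omega
  rintro s₁ ⟨hf, ⟨h1, h2⟩, h3⟩
  have e0 : s₁.nreg 0 = n := by rw [hf.n 0 (by decide)]; simp [h0]
  have e6 : s₁.nreg 6 = n := by rw [hf.n 6 (by decide)]; simp [h0]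
  simp [e0, h2] at h3
  have h1' : s₁.nreg 1 = K := le_antisymm h1 (hK ▸ Nat.clog_le_of_le_pow h3)
  rw [h1'] at h2
  clear h1 h3
  refine Runs.seq (Runs.of_wp ⟨by simp [hw0], ?_⟩ (by decide))
  refine Runs.seq (Runs.of_wp ⟨by simp [h1']; omega, ?_⟩ (by decide))
  refine Runs.seq ((Runs.loop (I := fun s' => ∃ b, b ≤ K ∧ s'.nreg 3 = 2 ^ b ∧ s'.nreg 5 = K - b ∧
      2 ^ b ≤ 2 * K + 1) (v := fun s' => s'.nreg 5) (V := K) (C := 12) ?_ ?_ ?_).mono ?_ ?_)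
  · exact ⟨0, by simp [h1']⟩
  · simp [h1']
  · rintro s₂ hf ⟨b, hb, h3, h5, h6⟩
    have e1 : s₂.nreg 1 = K := by rw [hf.n 1 (by decide)]; simp [h1']
    refine ⟨by simp [*]; omega, fun hlt => Runs.of_wp ?_ (by decide)⟩
    simp [h3, e1] at hlt
    -- The loop test gives `2 ^ b < K`. Hence `b < K`, so that `b + 1 ≤ K`, and the doubled block
    -- length is below `2 * K`.
    have : b < 2 ^ b := Nat.lt_two_pow_self
    have hp : 2 ^ (b + 1) = 2 ^ b * 2 := pow_succ _ _
    simp [h3, h5, hw0]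
    and_intros <;> try omega
    exact ⟨b + 1, by omega, by omega, by omega, by omega⟩
  · simp [Test.cost, NExp.cost]; omega
  rintro s₂ ⟨hf', ⟨b, hb, h3, h5, h6⟩, h4⟩
  have e1 : s₂.nreg 1 = K := by rw [hf'.n 1 (by decide)]; simp [h1']
  have e2 : s₂.nreg 2 = 2 ^ K := by rw [hf'.n 2 (by decide)]; simp [h2]
  have e6' : s₂.nreg 6 = n := by rw [hf'.n 6 (by decide)]; simp [e6]
  simp [h3, e1] at h4
  have hble : 2 ^ b ≤ 2 ^ K := Nat.pow_le_pow_right (by norm_num) hb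
  refine Runs.of_wp ⟨?_, b, hb, h4, h6, ?_⟩ (by decide)
  · simp [h3, e2]; omega
  · simp [h3, e2, e1, h5, e6']
    rw [← Nat.pow_div hb (by norm_num), Nat.mul_div_assoc _ (Nat.pow_dvd_pow 2 hb)]

/-- Fill the arrays 0, 1 up to the length in register 2 with copies of the first point. -/
def padInput : Prog :=
  .seq (.setN 7 (.reg 0)) <| .loop (.ltN (.reg 7) (.reg 2))
    (.seq (.putR 0 (.reg 7) (.get 0 (.const 0))) <|
      .seq (.putR 1 (.reg 7) (.get 1 (.const 0))) <| .setN 7 (.add (.reg 7) (.const 1)))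

theorem padInput_runs {n A : ℕ} {s : State} (hw : 4 * A + 8 < 2 ^ w) (hm : 2 * A + 1 < m)
    (h0 : s.nreg 0 = n) (h2 : s.nreg 2 = A) (hn : n ≤ A) :
    Runs w m padInput s (A * 30 + 20) fun s' => Frame padInput s s' ∧
      ∀ a < 2, ∀ t < A, s'.rarr a t = if t < n then s.rarr a t else s.rarr a 0 := by
  have hw0 := word_ne_zero hw
  refine Runs.frame ?_
  unfold padInput
  refine Runs.mono (T := 2 + (A * 30 + 10)) ?_ (by omega) (fun _ h => h)
  refine Runs.seq (Runs.of_wp ⟨by simp; omega, ?_⟩ (by decide))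
  refine ((Runs.loop (I := fun s' => n ≤ s'.nreg 7 ∧ s'.nreg 7 ≤ A ∧ ∀ a < 2,
      (∀ t < s'.nreg 7, s'.rarr a t = if t < n then s.rarr a t else s.rarr a 0) ∧
      s'.rarr a 0 = s.rarr a 0)
      (v := fun s' => A - s'.nreg 7) (V := A) (C := 20) ?_ ?_ ?_).mono ?_ ?_)
  · simp [h0, hn]
    intro a ha t ht h
    omega
  · simp
  · rintro s₁ hf ⟨h7, h7', hI⟩
    have e2 : s₁.nreg 2 = A := by rw [hf.n 2 (by decide)]; simp [h2]
    refine ⟨by simp [*]; omega, fun hlt => Runs.of_wp ?_ (by decide)⟩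
    simp [e2] at hlt
    simp [hw0]
    and_intros <;> try omega
    intro a ha
    obtain ⟨i1, i2⟩ := hI a (by omega)
    have key : (∀ t < s₁.nreg 7 + 1, Function.update (s₁.rarr a) (s₁.nreg 7) (s₁.rarr a 0) t =
        if t < n then s.rarr a t else s.rarr a 0) ∧
        Function.update (s₁.rarr a) (s₁.nreg 7) (s₁.rarr a 0) 0 = s.rarr a 0 := by
      refine ⟨fun t ht => ?_, ?_⟩
      · rcases Nat.lt_succ_iff_lt_or_eq.1 ht with ht | rfl
        · simpa [ht.ne] using i1 t ht
        · simp [i2]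
          intro; omega
      · by_cases h : 0 = s₁.nreg 7
        · rw [← h]; simp [i2]
        · simp [h, i2]
    obtain rfl | rfl : a = 0 ∨ a = 1 := by omega
    · simpa using key
    · simpa using key
  · simp [Test.cost, NExp.cost]; omega
  · rintro s' ⟨hf, ⟨h7, h7', hI⟩, hlt⟩ a ha t ht
    have e2 : s'.nreg 2 = A := by rw [hf.n 2 (by decide)]; simp [h2]
    simp [e2] at hlt
    exact (hI a ha).1 t (by omega)

/-! ### Merge sort -/

/-- The points with indices below `A` form the same set. -/
def SameRange (A : ℕ) (X Y X' Y' : ℕ → ℝ) : Prop :=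
  (∀ t < A, ∃ u < A, X' t = X u ∧ Y' t = Y u) ∧ ∀ u < A, ∃ t < A, X' t = X u ∧ Y' t = Y u

theorem SameRange.refl (A : ℕ) (X Y : ℕ → ℝ) : SameRange A X Y X Y :=
  ⟨fun t ht => ⟨t, ht, rfl, rfl⟩, fun t ht => ⟨t, ht, rfl, rfl⟩⟩

theorem SameRange.trans {A : ℕ} {X Y X' Y' X'' Y'' : ℕ → ℝ} (h : SameRange A X Y X' Y')
    (h' : SameRange A X' Y' X'' Y'') : SameRange A X Y X'' Y'' := by
  constructor
  · intro t ht
    obtain ⟨u, hu, e1, e2⟩ := h'.1 t ht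
    obtain ⟨v, hv, e3, e4⟩ := h.1 u hu
    exact ⟨v, hv, e1.trans e3, e2.trans e4⟩
  · intro v hv
    obtain ⟨u, hu, e3, e4⟩ := h.2 v hv
    obtain ⟨t, ht, e1, e2⟩ := h'.2 u hu
    exact ⟨t, ht, e1.trans e3, e2.trans e4⟩

/-- The index intervals of length `l` below `A` are sorted. -/
def SortedBlocks (A l : ℕ) (X : ℕ → ℝ) : Prop :=
  ∀ g, (g + 1) * l ≤ A → ∀ u v, g * l ≤ u → u ≤ v → v < (g + 1) * l → X u ≤ X v

/-- Merge the sorted intervals of length in register 8 pairwise. -/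
def mergeLevel : Prog :=
  .seq (.setN 9 (.const 0)) <|
  .seq (.loop (.ltN (.reg 9) (.reg 2))
    (.seq merge (.setN 9 (.add (.reg 9) (.mul (.const 2) (.reg 8)))))) <|
  .seq (.setN 9 (.const 0)) <|
  .loop (.ltN (.reg 9) (.reg 2)) (.seq (.putR 0 (.reg 9) (.get 2 (.reg 9))) <|
    .seq (.putR 1 (.reg 9) (.get 3 (.reg 9))) <| .setN 9 (.add (.reg 9) (.const 1)))

theorem mergeLevel_runs {A l G : ℕ} {s : State} (hw : 4 * A + 8 < 2 ^ w) (hm : 2 * A + 1 < m)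
    (h2 : s.nreg 2 = A) (h8 : s.nreg 8 = l) (hA : A = G * (2 * l)) (hl : 1 ≤ l)
    (hs : SortedBlocks A l (s.rarr 0)) :
    Runs w m mergeLevel s (A * 200 + 60) fun s' => Frame mergeLevel s s' ∧
      SortedBlocks A (2 * l) (s'.rarr 0) ∧
      SameRange A (s.rarr 0) (s.rarr 1) (s'.rarr 0) (s'.rarr 1) := by
  have hw0 := word_ne_zero hw
  have hGA : G ≤ A := by rw [hA]; exact Nat.le_mul_of_pos_right G (by omega)
  refine Runs.frame ?_
  unfold mergeLevel
  refine Runs.mono (T := 2 + ((A * 160 + 20) + (2 + (A * 40 + 10)))) ?_ (by omega) (fun _ h => h)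
  refine Runs.seq (Runs.of_wp ⟨by simp, ?_⟩ (by decide))
  -- Register 9 advances in steps of `2 * l`; the variant recovers the number `g` of finished pairs
  -- by division.
  refine Runs.seq ((Runs.loop (I := fun s' => ∃ g ≤ G, s'.nreg 9 = g * (2 * l) ∧
      (∀ g' < g, ∀ u v, g' * (2 * l) ≤ u → u ≤ v → v < (g' + 1) * (2 * l) →
        s'.rarr 2 u ≤ s'.rarr 2 v) ∧
      SameRange (g * (2 * l)) (s.rarr 0) (s.rarr 1) (s'.rarr 2) (s'.rarr 3))
      (v := fun s' => G - s'.nreg 9 / (2 * l)) (V := G) (C := 2 * l * 80 + 50) ?_ ?_ ?_).mono ?_ ?_)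
  · exact ⟨0, by omega, by simp, by omega, by simp [SameRange]⟩
  · simp
  · rintro s₁ hf ⟨g, hg, h9, hS, hR⟩
    have e8 : s₁.nreg 8 = l := by rw [hf.n 8 (by decide)]; simp [h8]
    have e2 : s₁.nreg 2 = A := by rw [hf.n 2 (by decide)]; simp [h2]
    have e0 : s₁.rarr 0 = s.rarr 0 := by rw [hf.a 0 (by decide)]; simp
    have e1 : s₁.rarr 1 = s.rarr 1 := by rw [hf.a 1 (by decide)]; simp
    have hgA : g * (2 * l) ≤ A := hA ▸ Nat.mul_le_mul_right _ hg
    refine ⟨by simp [*]; omega, fun hlt => ?_⟩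
    simp [e2, h9] at hlt
    have hgG : g < G := by
      rw [hA] at hlt
      exact Nat.lt_of_mul_lt_mul_right hlt
    have hgA' : (g + 1) * (2 * l) ≤ A := hA ▸ Nat.mul_le_mul_right _ hgG
    have hexp : (g + 1) * (2 * l) = g * (2 * l) + 2 * l := by ring
    refine Runs.mono (T := 2 * l * 80 + 40 + 6) ?_ (by omega) (fun _ h => h)
    refine Runs.seq ((merge_runs (A := A) hw hm e8 h9 (by omega) ?_ ?_).mono le_rfl ?_)
    · rw [e0]
      intro u v h1 h2 h3
      exact hs (2 * g) (by linarith) u v (by linarith) h2 (by linarith)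
    · rw [e0]
      intro u v h1 h2 h3
      exact hs (2 * g + 1) (by linarith) u v (by linarith) h2 (by linarith)
    rintro s₂ ⟨hf₂, hM, hold⟩
    have e8' : s₂.nreg 8 = l := by rw [hf₂.n 8 (by decide)]; exact e8
    have e9' : s₂.nreg 9 = g * (2 * l) := by rw [hf₂.n 9 (by decide)]; exact h9
    rw [e0, e1] at hM
    refine Runs.of_wp ?_ (by decide)
    simp [e8', e9']
    have hdiv : g * (2 * l) / (2 * l) = g := Nat.mul_div_cancel _ (by omega)
    have hdiv' : (g * (2 * l) + 2 * l) / (2 * l) = g + 1 := by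
      rw [← hexp]; exact Nat.mul_div_cancel _ (by omega)
    rw [hdiv', h9, hdiv]
    and_intros <;> try omega
    refine ⟨g + 1, hgG, hexp.symm, ?_, ?_⟩
    · intro g' hg' u v h1 h2 h3
      rcases Nat.lt_succ_iff_lt_or_eq.1 hg' with hlt' | rfl
      · have : (g' + 1) * (2 * l) ≤ g * (2 * l) := Nat.mul_le_mul_right _ hlt'
        rw [(hold u (by omega)).1, (hold v (by omega)).1]
        exact hS g' hlt' u v h1 h2 h3
      · exact hM.sorted u v h1 h2 (by omega)
    · rw [hexp]
      constructor
      · intro t ht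
        rcases Nat.lt_or_ge t (g * (2 * l)) with h | h
        · obtain ⟨u, hu, h3, h4⟩ := hR.1 t h
          exact ⟨u, by omega, by rw [(hold t h).1, h3], by rw [(hold t h).2, h4]⟩
        · obtain ⟨u, h3, h4, h5⟩ := hM.mem t h ht
          exact ⟨u, h4, h5⟩
      · intro u hu
        rcases Nat.lt_or_ge u (g * (2 * l)) with h | h
        · obtain ⟨t, ht, h3, h4⟩ := hR.2 u h
          exact ⟨t, by omega, by rw [(hold t ht).1, h3], by rw [(hold t ht).2, h4]⟩
        · rcases Nat.lt_or_ge u (g * (2 * l) + l) with h' | h'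
          · obtain ⟨t, h3, h4, h5⟩ := hM.mem_left u h h'
            exact ⟨t, h4, h5⟩
          · obtain ⟨t, h3, h4, h5⟩ := hM.mem_right u h' hu
            exact ⟨t, h4, h5⟩
  · simp [Test.cost, NExp.cost]
    nlinarith
  rintro s₁ ⟨hf, ⟨g, hg, h9, hS, hR⟩, hlt⟩
  have e2 : s₁.nreg 2 = A := by rw [hf.n 2 (by decide)]; simp [h2]
  simp [e2, h9] at hlt
  have hgA : g * (2 * l) = A := le_antisymm (hA ▸ Nat.mul_le_mul_right _ hg) hlt
  rw [hgA] at hR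
  have hD : SortedBlocks A (2 * l) (s₁.rarr 2) := fun g' hg' => hS g' (by
    rw [← hgA] at hg'
    exact Nat.le_of_mul_le_mul_right hg' (by omega))
  clear hS h9 hf
  refine Runs.seq (Runs.of_wp ⟨by simp, ?_⟩ (by decide))
  refine ((Runs.loop (I := fun s' => s'.nreg 9 ≤ A ∧ ∀ t < s'.nreg 9,
      s'.rarr 0 t = s₁.rarr 2 t ∧ s'.rarr 1 t = s₁.rarr 3 t)
      (v := fun s' => A - s'.nreg 9) (V := A) (C := 20) ?_ ?_ ?_).mono ?_ ?_)
  · simp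
  · simp
  · rintro s₂ hf ⟨h9, hI⟩
    have e2 : s₂.nreg 2 = A := by rw [hf.n 2 (by decide)]; simp [e2]
    have e3 : s₂.rarr 2 = s₁.rarr 2 := by rw [hf.a 2 (by decide)]; simp
    have e4 : s₂.rarr 3 = s₁.rarr 3 := by rw [hf.a 3 (by decide)]; simp
    refine ⟨by simp [*]; omega, fun hlt => Runs.of_wp ?_ (by decide)⟩
    simp [e2] at hlt
    simp [hw0, e3, e4]
    and_intros <;> try omega
    intro t ht
    rcases Nat.lt_or_eq_of_le ht with ht | rfl
    · simpa [ht.ne] using hI t ht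
    · simp
  · simp [Test.cost, NExp.cost]; omega
  · rintro s' ⟨hf, ⟨h9, hI⟩, hlt⟩
    have e2 : s'.nreg 2 = A := by rw [hf.n 2 (by decide)]; simp [e2]
    simp [e2] at hlt
    have hI' := fun t (ht : t < A) => hI t (by omega)
    refine ⟨fun g hg u v h1 h2 h3 => ?_, ?_, ?_⟩
    · rw [(hI' u (by omega)).1, (hI' v (by omega)).1]
      exact hD g hg u v h1 h2 h3
    · intro t ht
      rw [(hI' t ht).1, (hI' t ht).2]
      exact hR.1 t ht
    · intro u hu
      obtain ⟨t, ht, h⟩ := hR.2 u hu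
      exact ⟨t, ht, by rw [(hI' t ht).1, (hI' t ht).2]; exact h⟩

/-- Sort the first `2 ^ K` points by their first coordinates. -/
def sortPoints : Prog :=
  .seq (.setN 8 (.const 1)) <| .loop (.ltN (.reg 8) (.reg 2))
    (.seq mergeLevel (.setN 8 (.mul (.const 2) (.reg 8))))

theorem sortPoints_runs {K A : ℕ} {s : State} (hw : 4 * A + 8 < 2 ^ w) (hm : 2 * A + 1 < m)
    (h2 : s.nreg 2 = A) (hA : A = 2 ^ K) :
    Runs w m sortPoints s (K * (A * 200 + 80) + 20) fun s' => Frame sortPoints s s' ∧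
      (∀ u v, u ≤ v → v < A → s'.rarr 0 u ≤ s'.rarr 0 v) ∧
      SameRange A (s.rarr 0) (s.rarr 1) (s'.rarr 0) (s'.rarr 1) := by
  have hw0 := word_ne_zero hw
  refine Runs.frame ?_
  unfold sortPoints
  refine Runs.mono (T := 2 + (K * (A * 200 + 80) + 10)) ?_ (by omega) (fun _ h => h)
  refine Runs.seq (Runs.of_wp ⟨by simp [hw0], ?_⟩ (by decide))
  refine ((Runs.loop (I := fun s' => ∃ j ≤ K, s'.nreg 8 = 2 ^ j ∧
      SortedBlocks A (2 ^ j) (s'.rarr 0) ∧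
      SameRange A (s.rarr 0) (s.rarr 1) (s'.rarr 0) (s'.rarr 1))
      (v := fun s' => K - Nat.log 2 (s'.nreg 8)) (V := K) (C := A * 200 + 70) ?_ ?_ ?_).mono ?_ ?_)
  · refine ⟨0, by omega, by simp, ?_, by simpa using SameRange.refl _ _ _⟩
    intro g hg u v h1 h2 h3
    obtain rfl : u = v := by omega
    exact le_rfl
  · simp
  · rintro s₁ hf ⟨j, hj, h8, hS, hR⟩
    have e2 : s₁.nreg 2 = A := by rw [hf.n 2 (by decide)]; simp [h2]
    have hjK : 2 ^ j ≤ A := hA ▸ Nat.pow_le_pow_right (by norm_num) hj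
    refine ⟨by simp [*]; omega, fun hlt => ?_⟩
    simp [e2, h8, hA] at hlt
    replace hlt : j < K := (Nat.pow_lt_pow_iff_right (by norm_num)).1 hlt
    refine Runs.mono (T := A * 200 + 60 + 4) ?_ (by omega) (fun _ h => h)
    refine Runs.seq ((mergeLevel_runs (G := 2 ^ (K - (j + 1))) hw hm e2 h8 ?_ Nat.one_le_two_pow
      hS).mono le_rfl ?_)
    · rw [hA, ← pow_succ', ← pow_add]
      congr 1
      omega
    rintro s₂ ⟨hf₂, hS₂, hR₂⟩
    have e8 : s₂.nreg 8 = 2 ^ j := by rw [hf₂.n 8 (by decide)]; exact h8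
    refine Runs.of_wp ?_ (by decide)
    have hle : 2 ^ (j + 1) ≤ A := hA ▸ Nat.pow_le_pow_right (by norm_num) hlt
    rw [pow_succ'] at hle
    simp [e8, h8]
    rw [← pow_succ', Nat.log_pow (by norm_num)]
    rw [← pow_succ'] at hS₂ hle
    and_intros <;> try omega
    exact ⟨j + 1, hlt, rfl, hS₂, hR.trans hR₂⟩
  · simp only [Test.cost, NExp.cost]
    ring_nf
    omega
  · rintro s' ⟨hf, ⟨j, hj, h8, hS, hR⟩, hlt⟩
    have e2 : s'.nreg 2 = A := by rw [hf.n 2 (by decide)]; simp [h2]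
    simp [e2, h8] at hlt
    refine ⟨fun u v huv hv => ?_, hR⟩
    have : 2 ^ j ≤ A := hA ▸ Nat.pow_le_pow_right (by norm_num) hj
    exact hS 0 (by omega) u v (by omega) huv (by omega)

/-! ### The mirrored copy -/

/-- Append the points reflected at the vertical axis in reverse order. -/
def mirrorPoints : Prog :=
  .seq (.setN 7 (.const 0)) <| .loop (.ltN (.reg 7) (.reg 2))
    (.seq (.putR 0 (.sub (.mul (.const 2) (.reg 2)) (.add (.reg 7) (.const 1)))
        (.sub (.const 0) (.get 0 (.reg 7)))) <|
      .seq (.putR 1 (.sub (.mul (.const 2) (.reg 2)) (.add (.reg 7) (.const 1)))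
        (.get 1 (.reg 7))) <| .setN 7 (.add (.reg 7) (.const 1)))

theorem mirrorPoints_runs {A : ℕ} {s : State} (hw : 4 * A + 8 < 2 ^ w) (hm : 2 * A + 1 < m)
    (h2 : s.nreg 2 = A) :
    Runs w m mirrorPoints s (A * 50 + 20) fun s' => Frame mirrorPoints s s' ∧
      ∀ t < A, (s'.rarr 0 t = s.rarr 0 t ∧ s'.rarr 1 t = s.rarr 1 t) ∧
        s'.rarr 0 (2 * A - (t + 1)) = - s.rarr 0 t ∧ s'.rarr 1 (2 * A - (t + 1)) = s.rarr 1 t := by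
  have hw0 := word_ne_zero hw
  refine Runs.frame ?_
  unfold mirrorPoints
  refine Runs.mono (T := 2 + (A * 50 + 10)) ?_ (by omega) (fun _ h => h)
  refine Runs.seq (Runs.of_wp ⟨by simp, ?_⟩ (by decide))
  refine ((Runs.loop (I := fun s' => s'.nreg 7 ≤ A ∧
      (∀ t < A, s'.rarr 0 t = s.rarr 0 t ∧ s'.rarr 1 t = s.rarr 1 t) ∧
      ∀ t < s'.nreg 7, s'.rarr 0 (2 * A - (t + 1)) = - s.rarr 0 t ∧
        s'.rarr 1 (2 * A - (t + 1)) = s.rarr 1 t)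
      (v := fun s' => A - s'.nreg 7) (V := A) (C := 40) ?_ ?_ ?_).mono ?_ ?_)
  · simp
  · simp
  · rintro s₁ hf ⟨h7, hI, hJ⟩
    have e2 : s₁.nreg 2 = A := by rw [hf.n 2 (by decide)]; simp [h2]
    refine ⟨by simp [*]; omega, fun hlt => Runs.of_wp ?_ (by decide)⟩
    simp [e2] at hlt
    have hne : ∀ t < A, t ≠ 2 * A - (s₁.nreg 7 + 1) := by omega
    simp [hw0, e2]
    and_intros <;> try omega
    · intro t ht
      simpa [hne t ht] using hI t ht
    · intro t ht
      rcases Nat.lt_or_eq_of_le ht with ht | rfl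
      · simpa [show 2 * A - (t + 1) ≠ 2 * A - (s₁.nreg 7 + 1) by omega] using hJ t ht
      · simp [hI _ hlt]
  · simp [Test.cost, NExp.cost]; omega
  · rintro s' ⟨hf, ⟨h7, hI, hJ⟩, hlt⟩ t ht
    have e2 : s'.nreg 2 = A := by rw [hf.n 2 (by decide)]; simp [h2]
    simp [e2] at hlt
    exact ⟨hI t ht, hJ t (by omega)⟩

/-! ### Graham scan and bridge tables -/

/-- The topmost point of the stack has to be removed before the next point is put on it. -/
def topIsHidden : Test :=
  .and (.ltN (.const 1) (.reg 17)) (.and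
    (.not (.ltR
      (.mul (.sub (.get 1 (.reg 16)) (.get 7 (.sub (.reg 17) (.const 1))))
        (.sub (.get 6 (.sub (.reg 17) (.const 1))) (.get 6 (.sub (.reg 17) (.const 2)))))
      (.mul (.sub (.get 7 (.sub (.reg 17) (.const 1))) (.get 7 (.sub (.reg 17) (.const 2))))
        (.sub (.get 0 (.reg 16)) (.get 6 (.sub (.reg 17) (.const 1)))))))
    (.not (.and (.eqR (.get 6 (.sub (.reg 17) (.const 1))) (.get 0 (.reg 16)))
      (.ltR (.get 1 (.reg 16)) (.get 7 (.sub (.reg 17) (.const 1)))))))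

/-- Put the next point on the stack, and record the bridge if the point is in the right half. -/
def hullPush : Prog :=
  .seq (.branch (.ltN (.reg 16) (.reg 14)) (.setN 18 (.add (.reg 17) (.const 1)))
    (.branch (.ltN (.reg 17) (.reg 18)) (.setN 18 (.reg 17)) .skip)) <|
  .seq (.putR 6 (.reg 17) (.get 0 (.reg 16))) <|
  .seq (.putR 7 (.reg 17) (.get 1 (.reg 16))) <|
  .seq (.setN 17 (.add (.reg 17) (.const 1))) <|
  .seq (.branch (.ltN (.reg 16) (.reg 14)) .skip
    (.seq (.putR 4 (.add (.mul (.reg 8) (.reg 4)) (.div (.reg 16) (.reg 3)))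
      (.sub (.get 6 (.reg 18)) (.get 6 (.sub (.reg 18) (.const 1))))) <|
      .putR 5 (.add (.mul (.reg 8) (.reg 4)) (.div (.reg 16) (.reg 3)))
      (.sub (.get 7 (.reg 18)) (.get 7 (.sub (.reg 18) (.const 1)))))) <|
  .setN 16 (.add (.reg 16) (.const 1))

/-- One step of the scan that builds the upper hull. -/
def hullStep : Prog := .branch topIsHidden (.setN 17 (.sub (.reg 17) (.const 1))) hullPush

/-- Build the upper hull of the segment starting in register 13 point by point, and record the
bridges between its left half and its right half. -/
def hullSegment : Prog :=
  .seq (.setN 14 (.add (.reg 13) (.mul (.reg 9) (.reg 3)))) <|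
  .seq (.setN 15 (.add (.reg 14) (.mul (.reg 9) (.reg 3)))) <|
  .seq (.setN 16 (.reg 13)) <| .seq (.setN 17 (.const 0)) <| .seq (.setN 18 (.const 0)) <|
  .loop (.ltN (.reg 16) (.reg 15)) hullStep

/-- Invariant of the scan of a segment. -/
structure HullScan (X Y TX₀ TY₀ : ℕ → ℝ) (B off g mid e : ℕ) (s : State) : Prop where
  low : g ≤ s.nreg 16
  high : s.nreg 16 ≤ e
  lc_le : g + s.nreg 18 ≤ s.nreg 16
  stack : HullStack X Y g mid (s.nreg 16) (s.rarr 6) (s.rarr 7) (s.nreg 17) (s.nreg 18)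
  good : ∀ k, mid ≤ k * B → (k + 1) * B ≤ s.nreg 16 →
    Separates X Y g mid ((k + 1) * B) (s.rarr 4 (off + k)) (s.rarr 5 (off + k))
  old : ∀ i, i < off + mid / B → s.rarr 4 i = TX₀ i ∧ s.rarr 5 i = TY₀ i

/-- The cell of a block is overwritten at each of its points, and only the last write, at the end of
the block, has to be right. Earlier blocks and earlier segments use smaller cells and are not
disturbed. -/
theorem HullScan.record {X Y TX₀ TY₀ : ℕ → ℝ} {B off g mid e : ℕ} {s : State}
    (h : HullScan X Y TX₀ TY₀ B off g mid e s) (hmid : mid ≤ s.nreg 16)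
    (hB : 0 < B) {dx dy : ℝ}
    (hsep : Separates X Y g mid (s.nreg 16 + 1) dx dy) :
    (∀ k, mid ≤ k * B → (k + 1) * B ≤ s.nreg 16 + 1 → Separates X Y g mid ((k + 1) * B)
      (Function.update (s.rarr 4) (off + s.nreg 16 / B) dx (off + k))
      (Function.update (s.rarr 5) (off + s.nreg 16 / B) dy (off + k))) ∧
    ∀ i, i < off + mid / B →
      Function.update (s.rarr 4) (off + s.nreg 16 / B) dx i = TX₀ i ∧
      Function.update (s.rarr 5) (off + s.nreg 16 / B) dy i = TY₀ i := by
  constructor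
  · intro k hk hk'
    rcases hk'.lt_or_eq with hlt | heq
    · have hle : (k + 1) * B ≤ s.nreg 16 := by omega
      have : k < s.nreg 16 / B := (Nat.le_div_iff_mul_le hB).2 hle
      simpa [this.ne] using h.good k hk (by omega)
    · have : s.nreg 16 / B = k := by
        have hexp : (k + 1) * B = k * B + B := by ring
        have hlt : s.nreg 16 < (k + 1) * B := by omega
        exact Nat.div_eq_of_lt_le (by omega) hlt
      rw [heq, this]
      simpa using hsep
  · intro i hi
    have : mid / B ≤ s.nreg 16 / B := Nat.div_le_div_right hmid
    simpa [show i ≠ off + s.nreg 16 / B by omega] using h.old i hi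

theorem hullPush_runs {A B NB g mid e h : ℕ} {X Y TX₀ TY₀ : ℕ → ℝ} {s : State}
    (hw : 4 * A + 8 < 2 ^ w) (hm : 2 * A + 1 < m) (h3 : s.nreg 3 = B) (h4 : s.nreg 4 = NB)
    (h8 : s.nreg 8 = h) (h14 : s.nreg 14 = mid) (hBA : B ≤ A) (hhA : h ≤ A)
    (hB : 0 < B) (hNB : NB * B = 2 * A) (hT : h * NB + NB ≤ 2 * A) (hgm : g < mid)
    (hme : mid ≤ e) (he : e ≤ 2 * A) (hX : ∀ u v, g ≤ u → u ≤ v → v < e → X u ≤ X v)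
    (h0 : s.rarr 0 = X) (h1 : s.rarr 1 = Y)
    (hS : HullScan X Y TX₀ TY₀ B (h * NB) g mid e s) (hlt : s.nreg 16 < e)
    (hk : ∀ i, i + 2 = s.nreg 17 → KeepsTop (s.rarr 6 i) (s.rarr 7 i) (s.rarr 6 (i + 1))
      (s.rarr 7 (i + 1)) (X (s.nreg 16)) (Y (s.nreg 16))) :
    Runs w m hullPush s 80 fun s' => HullScan X Y TX₀ TY₀ B (h * NB) g mid e s' ∧
      s'.nreg 16 = s.nreg 16 + 1 ∧ s'.nreg 17 = s.nreg 17 + 1 := by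
  have hw0 := word_ne_zero hw
  have hsz := hS.stack.size
  have hlow := hS.low
  have hlc := hS.lc_le
  have htB : s.nreg 16 / B < NB := (Nat.div_lt_iff_lt_mul hB).2 (by omega)
  have hhNB : h * NB < 2 ^ w := by omega
  have hNBA : NB ≤ 2 * A := by omega
  refine Runs.of_wp ?_ (by decide)
  rcases Nat.lt_or_ge (s.nreg 16) mid with hlm | hml
  · simp [hullPush, *]
    and_intros <;> try omega
    have hst := hS.stack.push hlow hlt hX hk (.inl ⟨hlm, rfl⟩)
    exact {
      low := by simp; omega
      high := by simp; omega
      lc_le := by simp; omega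
      stack := by simpa [h0, h1] using hst
      -- Vacuous: while `t < mid`, no block of the right half has been completed.
      good := fun k hk' hk'' => by
        simp at hk''
        exfalso
        rw [Nat.add_mul] at hk''
        omega
      old := by simpa using hS.old }
  · have hst := hS.stack.push hlow hlt hX hk (.inr ⟨hml, by omega, rfl⟩)
    have hlp := hst.lc_pos (by omega)
    -- The point just pushed belongs to the right half and lies on top, so the new count of left
    -- entries is below the new height. Both ends of the bridge therefore exist.
    have hsep := hst.separates (by omega) (by omega)
      (fun u hu hu' μ => hS.stack.push_dom hu hu' μ)
    obtain ⟨hg, ho⟩ := hS.record hml hB hsep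
    have hn : ¬ s.nreg 16 < mid := by omega
    simp [hullPush, *]
    and_intros <;> try omega
    · intro hlt'
      rw [min_eq_right hlt'.le] at *
      and_intros <;> try omega
      exact {
        low := by simp; omega
        high := by simp; omega
        lc_le := by simp; omega
        stack := by simpa [h0, h1] using hst
        good := by simpa [h0, h1] using hg
        old := by simpa [h0, h1] using ho }
    · intro hlt'
      rw [min_eq_left hlt'] at *
      and_intros <;> try omega
      exact {
        low := by simp; omega
        high := by simp; omega
        lc_le := by simp; omega
        stack := by simpa [h0, h1] using hst
        good := by simpa [h0, h1] using hg
        old := by simpa [h0, h1] using ho }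

/-- Amortisation: in `2 * (e - t) + size` each unread point carries two credits, one for its push
and one for its possible pop. A push lowers the sum by one, and so does a pop. -/
theorem hullStep_runs {A B NB g mid e h : ℕ} {X Y TX₀ TY₀ : ℕ → ℝ} {s : State}
    (hw : 4 * A + 8 < 2 ^ w) (hm : 2 * A + 1 < m) (h3 : s.nreg 3 = B) (h4 : s.nreg 4 = NB)
    (h8 : s.nreg 8 = h) (h14 : s.nreg 14 = mid) (hBA : B ≤ A) (hhA : h ≤ A)
    (hB : 0 < B) (hNB : NB * B = 2 * A) (hT : h * NB + NB ≤ 2 * A) (hgm : g < mid)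
    (hme : mid ≤ e) (he : e ≤ 2 * A) (hX : ∀ u v, g ≤ u → u ≤ v → v < e → X u ≤ X v)
    (h0 : s.rarr 0 = X) (h1 : s.rarr 1 = Y)
    (hS : HullScan X Y TX₀ TY₀ B (h * NB) g mid e s) (hlt : s.nreg 16 < e) :
    Runs w m hullStep s 160 fun s' => HullScan X Y TX₀ TY₀ B (h * NB) g mid e s' ∧
      2 * (e - s'.nreg 16) + s'.nreg 17 < 2 * (e - s.nreg 16) + s.nreg 17 := by
  have hw0 := word_ne_zero hw
  have hsz := hS.stack.size
  have hlow := hS.low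
  -- The test first checks that the height is at least 2, which makes the truncated subtractions of
  -- the top indices exact.
  have key : topIsHidden.Holds s ↔ ∃ i, i + 2 = s.nreg 17 ∧ ¬ KeepsTop (s.rarr 6 i) (s.rarr 7 i)
      (s.rarr 6 (i + 1)) (s.rarr 7 (i + 1)) (X (s.nreg 16)) (Y (s.nreg 16)) := by
    constructor
    · rintro ⟨h, h', h''⟩
      simp at h h' h''
      refine ⟨s.nreg 17 - 2, by omega, ?_⟩
      rw [show s.nreg 17 - 2 + 1 = s.nreg 17 - 1 by omega, KeepsTop, ← h0, ← h1]
      rintro (c | c)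
      · linarith
      · exact absurd c.2 (not_lt.2 (h'' c.1))
    · rintro ⟨i, hi, hk⟩
      simp only [KeepsTop, not_or, not_and, not_lt, ← h0, ← h1] at hk
      simp [topIsHidden, ← hi]
      exact hk
  refine Runs.mono (T := topIsHidden.cost + 80 + 1) ?_ (by decide) (fun _ h => h)
  refine Runs.branch ?_ ?_ ?_
  · simp [topIsHidden, hw0]
    and_intros <;> try omega
  · intro hh
    obtain ⟨i, hi, hk⟩ := key.1 hh
    refine Runs.of_wp ?_ (by decide)
    have hpop := (hi ▸ hS.stack).pop hlt hX hk
    simp [hw0]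
    and_intros <;> try omega
    have e1 : s.nreg 17 - 1 = i + 1 := by omega
    exact {
      low := by simpa using hS.low
      high := by simpa using hS.high
      lc_le := by simpa using hS.lc_le
      stack := by simpa [e1] using hpop
      good := by simpa using hS.good
      old := by simpa using hS.old }
  · intro hh
    rw [key] at hh
    push Not at hh
    refine (hullPush_runs hw hm h3 h4 h8 h14 hBA hhA hB hNB hT hgm hme he hX h0 h1 hS hlt
      hh).mono le_rfl ?_
    rintro s' ⟨h, h', h''⟩
    exact ⟨h, by omega⟩

theorem hullSegment_runs {A B NB W g h : ℕ} {s : State}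
    (hw : 4 * A + 8 < 2 ^ w) (hm : 2 * A + 1 < m) (h3 : s.nreg 3 = B) (h4 : s.nreg 4 = NB)
    (h8 : s.nreg 8 = h) (h9 : s.nreg 9 = W) (h13 : s.nreg 13 = g) (hBA : B ≤ A) (hhA : h ≤ A)
    (hB : 0 < B) (hW : 0 < W) (hNB : NB * B = 2 * A) (hT : h * NB + NB ≤ 2 * A)
    (he : g + W * B + W * B ≤ 2 * A)
    (hX : ∀ u v, g ≤ u → u ≤ v → v < g + W * B + W * B → s.rarr 0 u ≤ s.rarr 0 v) :
    Runs w m hullSegment s (W * B * 800 + 40) fun s' => Frame hullSegment s s' ∧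
      s'.nreg 15 = g + W * B + W * B ∧
      (∀ k, g + W * B ≤ k * B → (k + 1) * B ≤ g + W * B + W * B →
        Separates (s.rarr 0) (s.rarr 1) g (g + W * B) ((k + 1) * B)
          (s'.rarr 4 (h * NB + k)) (s'.rarr 5 (h * NB + k))) ∧
      ∀ i, i < h * NB + (g + W * B) / B → s'.rarr 4 i = s.rarr 4 i ∧ s'.rarr 5 i = s.rarr 5 i := by
  have hw0 := word_ne_zero hw
  have hWB : 0 < W * B := Nat.mul_pos hW hB
  have hWle : W ≤ W * B := Nat.le_mul_of_pos_right W hB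
  refine Runs.frame ?_
  unfold hullSegment
  refine Runs.mono (T := 6 + (6 + (2 + (2 + (2 + (W * B * 800 + 20)))))) ?_ (by omega)
    (fun _ h => h)
  refine Runs.seq (Runs.of_wp ⟨by simp [*]; omega, ?_⟩ (by decide))
  refine Runs.seq (Runs.of_wp ⟨by simp [*]; omega, ?_⟩ (by decide))
  refine Runs.seq (Runs.of_wp ⟨by simp [*]; omega, ?_⟩ (by decide))
  refine Runs.seq (Runs.of_wp ⟨by simp, ?_⟩ (by decide))
  refine Runs.seq (Runs.of_wp ⟨by simp, ?_⟩ (by decide))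
  -- The segment has `2 * (W * B)` points with two credits each, whence `V = W * B * 4`.
  refine (Runs.loop
    (I := fun s' => HullScan (s.rarr 0) (s.rarr 1) (s.rarr 4) (s.rarr 5) B (h * NB) g (g + W * B)
      (g + W * B + W * B) s')
    (v := fun s' => 2 * (g + W * B + W * B - s'.nreg 16) + s'.nreg 17) (V := W * B * 4)
    (C := 160) ?_ ?_ ?_).mono ?_ ?_
  · exact {
      low := by simp [h13]
      high := by simp [h13]; omega
      lc_le := by simp [h13]
      stack := by simpa [h13] using HullStack.init _ _ _ _ _ _ _
      good := fun k hk hk' => by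
        simp [h13, Nat.add_mul] at hk'
        omega
      old := by simp }
  · simp [h13]; omega
  · intro s₁ hf hI
    have e3 : s₁.nreg 3 = B := by rw [hf.n 3 (by decide)]; simp [h3]
    have e4 : s₁.nreg 4 = NB := by rw [hf.n 4 (by decide)]; simp [h4]
    have e8 : s₁.nreg 8 = h := by rw [hf.n 8 (by decide)]; simp [h8]
    have e14 : s₁.nreg 14 = g + W * B := by rw [hf.n 14 (by decide)]; simp [h3, h9, h13]
    have e15 : s₁.nreg 15 = g + W * B + W * B := by rw [hf.n 15 (by decide)]; simp [h3, h9, h13]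
    have e0 : s₁.rarr 0 = s.rarr 0 := by rw [hf.a 0 (by decide)]; simp
    have e1 : s₁.rarr 1 = s.rarr 1 := by rw [hf.a 1 (by decide)]; simp
    have := hI.high
    refine ⟨by simp [*]; omega, fun hlt => ?_⟩
    simp [e15] at hlt
    exact hullStep_runs hw hm e3 e4 e8 e14 hBA hhA hB hNB hT (by omega) (by omega) he hX e0 e1
      hI hlt
  · simp [Test.cost, NExp.cost]; omega
  · rintro s' ⟨hf, hI, hlt⟩
    have e15 : s'.nreg 15 = g + W * B + W * B := by rw [hf.n 15 (by decide)]; simp [h3, h9, h13]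
    simp [e15] at hlt
    exact ⟨e15, fun k hk hk' => hI.good k hk (by omega), hI.old⟩

/-- Process all segments of one level: `2 ^ h` blocks (register 9) in a half. -/
def hullLevel : Prog :=
  .seq (.setN 13 (.const 0)) <|
  .loop (.ltN (.reg 13) (.mul (.const 2) (.reg 2))) (.seq hullSegment (.setN 13 (.reg 15)))

/-- The array cells `TX k, TY k` of the blocks `k` in right halves of segments with `W` blocks
in a half hold the bridges between the left half and the blocks of the right half up to `k`. -/
def LevelGood (X Y : ℕ → ℝ) (B W NB : ℕ) (TX TY : ℕ → ℝ) : Prop :=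
  ∀ c k, (2 * c + 1) * W ≤ k → k < (2 * c + 2) * W → k < NB →
    Separates X Y (2 * c * W * B) ((2 * c + 1) * W * B) ((k + 1) * B) (TX k) (TY k)

theorem hullLevel_runs {A B NB W G h : ℕ} {s : State}
    (hw : 4 * A + 8 < 2 ^ w) (hm : 2 * A + 1 < m) (h2 : s.nreg 2 = A)
    (h3 : s.nreg 3 = B) (h4 : s.nreg 4 = NB)
    (h8 : s.nreg 8 = h) (h9 : s.nreg 9 = W) (hBA : B ≤ A) (hhA : h ≤ A)
    (hB : 0 < B) (hW : 0 < W) (hNB : NB * B = 2 * A) (hT : h * NB + NB ≤ 2 * A)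
    (hA : A = G * (2 * (W * B)))
    (hX : ∀ u v, u ≤ v → v < A → s.rarr 0 u ≤ s.rarr 0 v)
    (hX' : ∀ u v, A ≤ u → u ≤ v → v < 2 * A → s.rarr 0 u ≤ s.rarr 0 v) :
    Runs w m hullLevel s (A * 1000 + 40) fun s' => Frame hullLevel s s' ∧
      LevelGood (s.rarr 0) (s.rarr 1) B W NB (fun k => s'.rarr 4 (h * NB + k))
        (fun k => s'.rarr 5 (h * NB + k)) ∧
      ∀ i, i < h * NB → s'.rarr 4 i = s.rarr 4 i ∧ s'.rarr 5 i = s.rarr 5 i := by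
  have hw0 := word_ne_zero hw
  have hWB : 0 < W * B := Nat.mul_pos hW hB
  set D := W * B with hD
  refine Runs.frame ?_
  unfold hullLevel
  refine Runs.mono (T := 2 + (2 * G * (D * 800 + 60) + 10)) ?_ (by nlinarith) (fun _ h => h)
  refine Runs.seq (Runs.of_wp ⟨by simp, ?_⟩ (by decide))
  refine (Runs.loop (I := fun s' => ∃ g ≤ 2 * G, s'.nreg 13 = g * (2 * D) ∧
      (∀ c < g, ∀ k, (2 * c + 1) * W ≤ k → k < (2 * c + 2) * W →
        Separates (s.rarr 0) (s.rarr 1) (2 * c * W * B) ((2 * c + 1) * W * B) ((k + 1) * B)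
          (s'.rarr 4 (h * NB + k)) (s'.rarr 5 (h * NB + k))) ∧
      ∀ i, i < h * NB → s'.rarr 4 i = s.rarr 4 i ∧ s'.rarr 5 i = s.rarr 5 i)
    (v := fun s' => 2 * G - s'.nreg 13 / (2 * D)) (V := 2 * G)
    (C := D * 800 + 50) ?_ ?_ ?_).mono ?_ ?_
  · exact ⟨0, by simp⟩
  · simp
  · rintro s₁ hf ⟨g, hg, h13, hI, hold⟩
    have e2 : s₁.nreg 2 = A := by rw [hf.n 2 (by decide)]; simp [h2]
    have e3 : s₁.nreg 3 = B := by rw [hf.n 3 (by decide)]; simp [h3]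
    have e4 : s₁.nreg 4 = NB := by rw [hf.n 4 (by decide)]; simp [h4]
    have e8 : s₁.nreg 8 = h := by rw [hf.n 8 (by decide)]; simp [h8]
    have e9 : s₁.nreg 9 = W := by rw [hf.n 9 (by decide)]; simp [h9]
    have e0 : s₁.rarr 0 = s.rarr 0 := by rw [hf.a 0 (by decide)]; simp
    have e1 : s₁.rarr 1 = s.rarr 1 := by rw [hf.a 1 (by decide)]; simp
    have hgA : g * (2 * D) ≤ 2 * A := by
      have := Nat.mul_le_mul_right (2 * D) hg
      rw [hA]; linarith
    refine ⟨by simp [e2, h13]; omega, fun hlt => ?_⟩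
    simp [e2, h13] at hlt
    have hgG : g < 2 * G := by
      by_contra hc
      have := Nat.mul_le_mul_right (2 * D) (not_lt.1 hc)
      rw [hA] at hlt
      linarith
    have hexp : (g + 1) * (2 * D) = g * (2 * D) + D + D := by ring
    have hgA' : (g + 1) * (2 * D) ≤ 2 * A := by
      have := Nat.mul_le_mul_right (2 * D) hgG
      rw [hA]; linarith
    -- The array as a whole is not sorted at `A`, where the mirrored copy starts, but no segment
    -- straddles this boundary because `2 * D` divides `A`.
    have hcross : g * (2 * D) + D + D ≤ A ∨ A ≤ g * (2 * D) := by
      rcases Nat.lt_or_ge g G with h | h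
      · left
        rw [← hexp, hA]
        exact Nat.mul_le_mul_right _ h
      · right
        rw [hA]
        exact Nat.mul_le_mul_right _ h
    refine Runs.mono (T := D * 800 + 40 + 2) ?_ (by omega) (fun _ h => h)
    refine Runs.seq ((hullSegment_runs hw hm e3 e4 e8 e9 h13 hBA hhA hB hW hNB hT (by omega)
      ?_).mono le_rfl ?_)
    · rw [e0]
      intro u v h1 h2 h3
      rcases hcross with h | h
      · exact hX u v h2 (by omega)
      · exact hX' u v (by omega) h2 (by omega)
    rintro s₂ ⟨hf₂, h15, hgood, hold₂⟩
    rw [e0, e1, ← hD] at hgood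
    rw [← hD] at h15 hold₂
    refine Runs.of_wp ?_ (by decide)
    have hdiv : g * (2 * D) / (2 * D) = g := Nat.mul_div_cancel _ (by omega)
    have hdiv' : (g * (2 * D) + D + D) / (2 * D) = g + 1 := by
      rw [← hexp]; exact Nat.mul_div_cancel _ (by omega)
    have hmidB : (g * (2 * D) + D) / B = (2 * g + 1) * W := by
      rw [hD, show g * (2 * (W * B)) + W * B = (2 * g + 1) * W * B by ring]
      exact Nat.mul_div_cancel _ hB
    simp [h15]
    rw [hdiv', h13, hdiv]
    and_intros <;> try omega
    refine ⟨g + 1, hgG, hexp.symm, ?_, ?_⟩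
    · intro c hc k hk hk'
      rcases Nat.lt_succ_iff_lt_or_eq.1 hc with hc | rfl
      · have hkg : k < (2 * g + 1) * W := hk'.trans_le (Nat.mul_le_mul_right _ (by omega))
        rw [(hold₂ _ (by omega)).1, (hold₂ _ (by omega)).2]
        exact hI c hc k hk hk'
      · have a1 := Nat.mul_le_mul_right B hk
        have a2 : (k + 1) * B ≤ (2 * c + 2) * W * B :=
          Nat.mul_le_mul_right B (Nat.succ_le_of_lt hk')
        have b1 : (2 * c + 1) * W * B = c * (2 * D) + D := by rw [hD]; ring
        have b2 : (2 * c + 2) * W * B = c * (2 * D) + D + D := by rw [hD]; ring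
        have b3 : 2 * c * W * B = c * (2 * D) := by rw [hD]; ring
        rw [b1, b3]
        exact hgood k (by omega) (by omega)
    · intro i hi
      rw [(hold₂ _ (by omega)).1, (hold₂ _ (by omega)).2]
      exact hold i hi
  · simp [Test.cost, NExp.cost]
    nlinarith
  · rintro s' ⟨hf, ⟨g, hg, h13, hI, hold⟩, hlt⟩
    have e2 : s'.nreg 2 = A := by rw [hf.n 2 (by decide)]; simp [h2]
    simp [e2, h13] at hlt
    refine ⟨fun c k hk hk' hkN => hI c ?_ k hk hk', hold⟩
    -- With `c ≥ g`, block `k` would start beyond cell `2 * A`, against `k < NB`.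
    by_contra hc
    have h1 : (2 * g + 1) * W ≤ (2 * c + 1) * W := Nat.mul_le_mul_right _ (by omega)
    have h2 : (2 * g + 1) * W ≤ k := h1.trans hk
    have h3 : (2 * g + 1) * W * B < NB * B := Nat.mul_lt_mul_of_pos_right (by omega) hB
    rw [hNB] at h3
    have b1 : (2 * g + 1) * W * B = g * (2 * D) + D := by rw [hD]; ring
    omega

/-- Build the bridge tables of all levels. -/
def buildTables : Prog :=
  .seq (.setN 8 (.const 0)) <| .seq (.setN 9 (.const 1)) <|
  .loop (.ltN (.reg 8) (.reg 5)) (.seq hullLevel (.seq (.setN 8 (.add (.reg 8) (.const 1)))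
    (.setN 9 (.mul (.const 2) (.reg 9)))))

theorem buildTables_runs {A B H : ℕ} {s : State}
    (hw : 4 * A + 8 < 2 ^ w) (hm : 2 * A + 1 < m) (h2 : s.nreg 2 = A)
    (h3 : s.nreg 3 = B) (h4 : s.nreg 4 = 2 * 2 ^ H) (h5 : s.nreg 5 = H)
    (hB : 0 < B) (hA : A = 2 ^ H * B) (hHB : H ≤ B)
    (hX : ∀ u v, u ≤ v → v < A → s.rarr 0 u ≤ s.rarr 0 v)
    (hX' : ∀ u v, A ≤ u → u ≤ v → v < 2 * A → s.rarr 0 u ≤ s.rarr 0 v) :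
    Runs w m buildTables s (H * (A * 1000 + 80) + 20) fun s' => Frame buildTables s s' ∧
      ∀ h < H, LevelGood (s.rarr 0) (s.rarr 1) B (2 ^ h) (2 * 2 ^ H)
        (fun k => s'.rarr 4 (h * (2 * 2 ^ H) + k)) (fun k => s'.rarr 5 (h * (2 * 2 ^ H) + k)) := by
  have hw0 := word_ne_zero hw
  have hHA : 2 ^ H ≤ A := hA ▸ Nat.le_mul_of_pos_right _ hB
  have hHlt : H < 2 ^ H := Nat.lt_two_pow_self
  refine Runs.frame ?_
  unfold buildTables
  refine Runs.mono (T := 2 + (2 + (H * (A * 1000 + 80) + 10))) ?_ (by omega) (fun _ h => h)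
  refine Runs.seq (Runs.of_wp ⟨by simp, ?_⟩ (by decide))
  refine Runs.seq (Runs.of_wp ⟨by simp [hw0], ?_⟩ (by decide))
  refine (Runs.loop (I := fun s' => s'.nreg 8 ≤ H ∧ s'.nreg 9 = 2 ^ s'.nreg 8 ∧
      ∀ h < s'.nreg 8, LevelGood (s.rarr 0) (s.rarr 1) B (2 ^ h) (2 * 2 ^ H)
        (fun k => s'.rarr 4 (h * (2 * 2 ^ H) + k)) (fun k => s'.rarr 5 (h * (2 * 2 ^ H) + k)))
    (v := fun s' => H - s'.nreg 8) (V := H)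
    (C := A * 1000 + 60) ?_ ?_ ?_).mono ?_ ?_
  · simp
  · simp
  · rintro s₁ hf ⟨h8, h9, hI⟩
    have e2 : s₁.nreg 2 = A := by rw [hf.n 2 (by decide)]; simp [h2]
    have e3 : s₁.nreg 3 = B := by rw [hf.n 3 (by decide)]; simp [h3]
    have e4 : s₁.nreg 4 = 2 * 2 ^ H := by rw [hf.n 4 (by decide)]; simp [h4]
    have e5 : s₁.nreg 5 = H := by rw [hf.n 5 (by decide)]; simp [h5]
    have e0 : s₁.rarr 0 = s.rarr 0 := by rw [hf.a 0 (by decide)]; simp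
    have e1 : s₁.rarr 1 = s.rarr 1 := by rw [hf.a 1 (by decide)]; simp
    refine ⟨by simp [*]; omega, fun hlt => ?_⟩
    simp [e5] at hlt
    obtain ⟨h, hh⟩ : ∃ h, s₁.nreg 8 = h := ⟨_, rfl⟩
    rw [hh] at hlt hI h9
    refine Runs.mono (T := A * 1000 + 40 + (4 + 4)) ?_ (by omega) (fun _ h => h)
    have hsplit : 2 ^ H = 2 ^ (H - (h + 1)) * (2 * 2 ^ h) := by
      rw [← pow_succ', ← pow_add]
      congr 1
      omega
    have hBA : B ≤ A := hA ▸ Nat.le_mul_of_pos_left _ (by positivity)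
    -- The storage bound: since `h + 1 ≤ H ≤ B`, the first `h + 1` levels occupy at most `B * (2 * 2
    -- ^ H) = 2 * A` cells.
    have hT : h * (2 * 2 ^ H) + 2 * 2 ^ H ≤ 2 * A := by
      have : (h + 1) * 2 ^ H ≤ B * 2 ^ H := Nat.mul_le_mul_right _ (by omega)
      rw [hA]; linarith
    refine Runs.seq ((hullLevel_runs (G := 2 ^ (H - (h + 1))) hw hm e2 e3 e4 hh h9 hBA (by omega)
      hB (by positivity) (by rw [hA]; ring) hT (by rw [hA, hsplit]; ring) (by rwa [e0])
      (by rwa [e0])).mono le_rfl ?_)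
    rintro s₂ ⟨hf₂, hgood, hold⟩
    have e8 : s₂.nreg 8 = h := by rw [hf₂.n 8 (by decide)]; exact hh
    have e9 : s₂.nreg 9 = 2 ^ h := by rw [hf₂.n 9 (by decide)]; exact h9
    rw [e0, e1] at hgood
    have : 2 * 2 ^ h ≤ 2 ^ H := hsplit ▸ Nat.le_mul_of_pos_left _ (by positivity)
    refine Runs.of_wp ?_ (by decide)
    simp [e8, e9, hh, hw0]
    and_intros <;> try omega
    · intro h' hh'
      rcases Nat.lt_or_eq_of_le hh' with hlt' | rfl
      · intro c k hk hk' hkN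
        have : (h' + 1) * (2 * 2 ^ H) ≤ h * (2 * 2 ^ H) := Nat.mul_le_mul_right _ hlt'
        rw [Nat.add_mul] at this
        dsimp only
        rw [(hold _ (by omega)).1, (hold _ (by omega)).2]
        exact hI h' hlt' c k hk hk' hkN
      · exact hgood
  · simp [Test.cost, NExp.cost]
    nlinarith
  · rintro s' ⟨hf, ⟨h8, h9, hI⟩, hlt⟩
    have e5 : s'.nreg 5 = H := by rw [hf.n 5 (by decide)]; simp [h5]
    simp [e5] at hlt
    exact fun h hh => hI h (by omega)

/-! ### Scanning and locating blocks -/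

/-- The point of index `t` lies in the strip `[lo, hi]` above the line of slope `μ` and
intercept `c`. -/
def Hit (lo hi μ c : ℝ) (X Y : ℕ → ℝ) (t : ℕ) : Prop :=
  lo ≤ X t ∧ X t ≤ hi ∧ c < Y t - μ * X t

/-- The memory holds the points `X, Y` in `2 * 2 ^ H` blocks of length `B`, and their tables. -/
structure Loaded (B H : ℕ) (X Y : ℕ → ℝ) (s : State) : Prop where
  len : s.nreg 3 = B
  num : s.nreg 4 = 2 * 2 ^ H
  xs : s.rarr 0 = X
  ys : s.rarr 1 = Y
  good : ∀ h < H, LevelGood X Y B (2 ^ h) (2 * 2 ^ H)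
    (fun k => s.rarr 4 (h * (2 * 2 ^ H) + k)) (fun k => s.rarr 5 (h * (2 * 2 ^ H) + k))

theorem Loaded.frame {B H : ℕ} {X Y : ℕ → ℝ} {p : Prog} {s s' : State} (h : Loaded B H X Y s)
    (hf : Frame p s s') (h3 : 3 ∉ p.writesN) (h4 : 4 ∉ p.writesN) (ha : p.writesA = []) :
    Loaded B H X Y s' := by
  have ha' : ∀ a, s'.rarr a = s.rarr a := fun a => hf.a a (by simp [ha])
  exact ⟨by rw [hf.n 3 h3, h.len], by rw [hf.n 4 h4, h.num], by rw [ha', h.xs], by rw [ha', h.ys],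
    by simpa [ha'] using h.good⟩

/-- The strip and the line of the current query. -/
structure Line (lo hi μ c : ℝ) (s : State) : Prop where
  lo : s.rreg 4 = lo
  hi : s.rreg 5 = hi
  slope : s.rreg 6 = μ
  icept : s.rreg 7 = c

theorem Line.frame {lo hi μ c : ℝ} {p : Prog} {s s' : State} (h : Line lo hi μ c s)
    (hf : Frame p s s') (hr : p.writesR = []) : Line lo hi μ c s' := by
  have hr' : ∀ i, s'.rreg i = s.rreg i := fun i => hf.r i (by simp [hr])
  exact ⟨by rw [hr', h.lo], by rw [hr', h.hi], by rw [hr', h.slope], by rw [hr', h.icept]⟩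

/-- Test the points of the block in register 10 one by one. -/
def scanBlock : Prog :=
  .seq (.setN 15 (.mul (.reg 10) (.reg 3))) <| .seq (.setN 16 (.add (.reg 15) (.reg 3))) <|
  .loop (.ltN (.reg 15) (.reg 16)) (.seq
    (.branch (.and (.not (.ltR (.get 0 (.reg 15)) (.reg 4)))
        (.and (.not (.ltR (.reg 5) (.get 0 (.reg 15))))
          (.ltR (.reg 7) (.sub (.get 1 (.reg 15)) (.mul (.reg 6) (.get 0 (.reg 15)))))))
      (.setN 0 (.const 1)) .skip)
    (.setN 15 (.add (.reg 15) (.const 1))))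

theorem scanBlock_runs {A B H k : ℕ} {X Y : ℕ → ℝ} {lo hi μ c : ℝ} {s : State}
    (hw : 4 * A + 8 < 2 ^ w) (hm : 2 * A + 1 < m) (hs : Loaded B H X Y s)
    (hl : Line lo hi μ c s) (h10 : s.nreg 10 = k) (hB : 0 < B)
    (hk : (k + 1) * B ≤ 2 * A) :
    Runs w m scanBlock s (B * 60 + 40) fun s' => Frame scanBlock s s' ∧
      (s'.nreg 0 = 0 ↔ s.nreg 0 = 0 ∧
        ∀ t, k * B ≤ t → t < (k + 1) * B → ¬ Hit lo hi μ c X Y t) := by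
  have hw0 := word_ne_zero hw
  have h3 := hs.len
  have hexp : (k + 1) * B = k * B + B := by ring
  rw [hexp] at hk ⊢
  have hkB : k ≤ k * B := Nat.le_mul_of_pos_right k hB
  refine Runs.frame ?_
  unfold scanBlock
  refine Runs.mono (T := 6 + (6 + (B * 60 + 10))) ?_ (by omega) (fun _ h => h)
  refine Runs.seq (Runs.of_wp ⟨by simp [*]; omega, ?_⟩ (by decide))
  refine Runs.seq (Runs.of_wp ⟨by simp [*]; omega, ?_⟩ (by decide))
  refine (Runs.loop (I := fun s' => k * B ≤ s'.nreg 15 ∧ s'.nreg 15 ≤ k * B + B ∧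
      (s'.nreg 0 = 0 ↔ s.nreg 0 = 0 ∧
        ∀ t, k * B ≤ t → t < s'.nreg 15 → ¬ Hit lo hi μ c X Y t))
    (v := fun s' => k * B + B - s'.nreg 15) (V := B) (C := 40) ?_ ?_ ?_).mono ?_ ?_
  · simp [h10, h3]
    intro _ t h1 h2
    omega
  · simp [h10, h3]
  · rintro s₁ hf ⟨h15, h15', hI⟩
    have e16 : s₁.nreg 16 = k * B + B := by rw [hf.n 16 (by decide)]; simp [h10, h3]
    have e0 : s₁.rarr 0 = X := by rw [hf.a 0 (by decide)]; simp [hs.xs]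
    have e1 : s₁.rarr 1 = Y := by rw [hf.a 1 (by decide)]; simp [hs.ys]
    have r4 : s₁.rreg 4 = lo := by rw [hf.r 4 (by decide)]; simp [hl.lo]
    have r5 : s₁.rreg 5 = hi := by rw [hf.r 5 (by decide)]; simp [hl.hi]
    have r6 : s₁.rreg 6 = μ := by rw [hf.r 6 (by decide)]; simp [hl.slope]
    have r7 : s₁.rreg 7 = c := by rw [hf.r 7 (by decide)]; simp [hl.icept]
    refine ⟨by simp [e16]; omega, fun hlt => Runs.of_wp ?_ (by decide)⟩
    simp [e16] at hlt
    have hstep : (∀ t, k * B ≤ t → t < s₁.nreg 15 + 1 → ¬ Hit lo hi μ c X Y t) ↔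
        (∀ t, k * B ≤ t → t < s₁.nreg 15 → ¬ Hit lo hi μ c X Y t) ∧
        ¬ Hit lo hi μ c X Y (s₁.nreg 15) := by
      constructor
      · exact fun h => ⟨fun t h1 h2 => h t h1 (by omega), h _ h15 (by omega)⟩
      · rintro ⟨h, h'⟩ t h1 h2
        rcases Nat.lt_succ_iff_lt_or_eq.1 h2 with h2 | rfl
        exacts [h t h1 h2, h']
    simp only [Prog.wp, Test.Ok, Test.Holds, NExp.Ok, RExp.Ok, NExp.val, RExp.val,
      e0, e1, r4, r5, r6, r7, not_lt, State.setN_nreg]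
    have hhit : (lo ≤ X (s₁.nreg 15) ∧ X (s₁.nreg 15) ≤ hi ∧
      c < Y (s₁.nreg 15) - μ * X (s₁.nreg 15)) ↔ Hit lo hi μ c X Y (s₁.nreg 15) := Iff.rfl
    rw [hhit]
    simp [hw0]
    have hle : ∀ t, t ≤ s₁.nreg 15 ↔ t < s₁.nreg 15 + 1 := by omega
    simp only [hle, hstep]
    and_intros <;> try omega
    · intro hh
      and_intros <;> try omega
      exact fun _ => ⟨_, h15, by omega, hh⟩
    · intro hh
      and_intros <;> try omega
      simp [hh, hI]
  · simp [Test.cost, NExp.cost]; omega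
  · rintro s' ⟨hf, ⟨h15, h15', hI⟩, hlt⟩
    have e16 : s'.nreg 16 = k * B + B := by rw [hf.n 16 (by decide)]; simp [h10, h3]
    simp [e16] at hlt
    rwa [show s'.nreg 15 = k * B + B by omega] at hI

/-- Find the block in which the first coordinates reach the lower end of the strip, among the
blocks of the copy that starts with the block in register 10. -/
def locateBlock : Prog :=
  .seq (.setN 9 (.div (.reg 4) (.const 2))) <|
  .loop (.ltN (.const 1) (.reg 9)) (.seq (.setN 9 (.div (.reg 9) (.const 2)))
    (.branch (.ltR (.get 0 (.sub (.mul (.add (.reg 10) (.reg 9)) (.reg 3)) (.const 1))) (.reg 4))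
      (.setN 10 (.add (.reg 10) (.reg 9))) .skip))

/-- Binary search on the last points of the blocks. The disjuncts `i = k` and `i + 1 = k + 2 ^ H`
cover a side that no comparison has bounded. Only comparisons are recorded here; sortedness enters
when they are used. -/
theorem locateBlock_runs {A B H k : ℕ} {X Y : ℕ → ℝ} {s : State}
    (hw : 4 * A + 8 < 2 ^ w) (hm : 2 * A + 1 < m) (hs : Loaded B H X Y s)
    (hA : A = 2 ^ H * B) (h10 : s.nreg 10 = k) (hB : 0 < B) (hk : k ≤ 2 ^ H) :
    Runs w m locateBlock s (H * 40 + 40) fun s' => Frame locateBlock s s' ∧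
      ∃ i, s'.nreg 10 = i ∧ k ≤ i ∧ i < k + 2 ^ H ∧ (i = k ∨ X (i * B - 1) < s.rreg 4) ∧
        (i + 1 = k + 2 ^ H ∨ s.rreg 4 ≤ X ((i + 1) * B - 1)) := by
  have hw0 := word_ne_zero hw
  have h3 := hs.len
  have h4 := hs.num
  have hHA : 2 ^ H ≤ A := hA ▸ Nat.le_mul_of_pos_right _ hB
  have hBA : B ≤ A := hA ▸ Nat.le_mul_of_pos_left _ (by positivity)
  refine Runs.frame ?_
  unfold locateBlock
  refine Runs.mono (T := 6 + (H * 40 + 10)) ?_ (by omega) (fun _ h => h)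
  refine Runs.seq (Runs.of_wp ⟨by simp [*]; omega, ?_⟩ (by decide))
  refine (Runs.loop (I := fun s' => ∃ g ≤ H, s'.nreg 9 = 2 ^ g ∧ k ≤ s'.nreg 10 ∧
      s'.nreg 10 + 2 ^ g ≤ k + 2 ^ H ∧ (s'.nreg 10 = k ∨ X (s'.nreg 10 * B - 1) < s.rreg 4) ∧
      (s'.nreg 10 + 2 ^ g = k + 2 ^ H ∨ s.rreg 4 ≤ X ((s'.nreg 10 + 2 ^ g) * B - 1)))
    (v := fun s' => Nat.log 2 (s'.nreg 9)) (V := H) (C := 30) ?_ ?_ ?_).mono ?_ ?_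
  · exact ⟨H, le_rfl, by simp [h4, h10]⟩
  · simp [h4, Nat.log_pow]
  · rintro s₁ hf ⟨g, hg, h9, b1, b2, b3, b4⟩
    have e3 : s₁.nreg 3 = B := by rw [hf.n 3 (by decide)]; simp [h3]
    have e0 : s₁.rarr 0 = X := by rw [hf.a 0 (by decide)]; simp [hs.xs]
    have r4 : s₁.rreg 4 = s.rreg 4 := by rw [hf.r 4 (by decide)]; simp
    have hgH : 2 ^ g ≤ 2 ^ H := Nat.pow_le_pow_right (by norm_num) hg
    refine ⟨by simp [h9, hw0]; omega, fun hlt => Runs.of_wp ?_ (by decide)⟩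
    obtain ⟨g, rfl⟩ : ∃ g', g = g' + 1 := ⟨g - 1, by
      rcases g with _ | g
      · simp [h9] at hlt
      · rfl⟩
    have hsucc : 2 ^ (g + 1) = 2 ^ g + 2 ^ g := by ring
    have hhalf : 2 ^ (g + 1) / 2 = 2 ^ g := by omega
    have hle : (s₁.nreg 10 + 2 ^ g) * B ≤ 2 * A := by
      rw [hA, ← Nat.mul_assoc]
      exact Nat.mul_le_mul_right _ (by omega)
    simp [h9, hhalf, e3, e0, r4, hw0, Nat.log_pow]
    and_intros <;> try omega
    · intro hx
      and_intros <;> try omega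
      · exact .inr hx
      · rwa [Nat.add_assoc, ← hsucc]
    · intro hx
      and_intros <;> try omega
      exact .inr hx
  · simp [Test.cost, NExp.cost]; omega
  · rintro s' ⟨hf, ⟨g, hg, h9, b1, b2, b3, b4⟩, hlt⟩
    simp [h9] at hlt
    have hg0 : g = 0 := by
      rcases g with _ | g
      · rfl
      · have : 2 ^ (g + 1) = 2 * 2 ^ g := pow_succ' _ _
        have := Nat.one_le_two_pow (n := g)
        omega
    subst hg0
    exact ⟨_, rfl, b1, by simpa using b2, b3, by simpa using b4⟩

/-! ### Descent along the bridges -/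

/-- Walk down from the prefix ending with the block in register 10 of a segment with `2 ^ h`
blocks (`h` in register 8, `2 ^ h` in register 9) to a block with a highest point. -/
def descend : Prog :=
  .loop (.ltN (.const 0) (.reg 8)) (.seq (.setN 8 (.sub (.reg 8) (.const 1))) <|
    .seq (.setN 9 (.div (.reg 9) (.const 2))) <|
    .branch (.and (.ltN (.mul (.div (.div (.reg 10) (.reg 9)) (.const 2)) (.const 2))
        (.div (.reg 10) (.reg 9)))
      (.not (.ltR (.mul (.reg 6) (.get 4 (.add (.mul (.reg 8) (.reg 4)) (.reg 10))))
        (.get 5 (.add (.mul (.reg 8) (.reg 4)) (.reg 10))))))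
      (.setN 10 (.sub (.mul (.div (.reg 10) (.reg 9)) (.reg 9)) (.const 1))) .skip)

/-- On the indices `[a, b)` the maximum of `Y - μ * X` is attained in `[a', b')`. -/
def Dominated (X Y : ℕ → ℝ) (μ : ℝ) (a b a' b' : ℕ) : Prop :=
  ∀ q, a ≤ q → q < b → ∃ p, a' ≤ p ∧ p < b' ∧ Y q - μ * X q ≤ Y p - μ * X p

theorem Dominated.trans {X Y : ℕ → ℝ} {μ : ℝ} {a b a' b' a'' b'' : ℕ}
    (h : Dominated X Y μ a b a' b') (h' : Dominated X Y μ a' b' a'' b'') :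
    Dominated X Y μ a b a'' b'' := by
  intro q h1 h2
  obtain ⟨p, h3, h4, h5⟩ := h q h1 h2
  obtain ⟨r, h6, h7, h8⟩ := h' p h3 h4
  exact ⟨r, h6, h7, h5.trans h8⟩

theorem Separates.dominated_left {X Y : ℕ → ℝ} {s mid e : ℕ} {dx dy μ : ℝ}
    (h : Separates X Y s mid e dx dy) (hμ : dy ≤ μ * dx) : Dominated X Y μ s e s mid := by
  intro q h1 h2
  rcases Nat.lt_or_ge q mid with h3 | h3
  · exact ⟨q, h1, h3, le_rfl⟩
  · exact (h μ).1 hμ q h3 h2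

theorem Separates.dominated_right {X Y : ℕ → ℝ} {s mid e : ℕ} {dx dy μ : ℝ}
    (h : Separates X Y s mid e dx dy) (hμ : μ * dx < dy) : Dominated X Y μ s e mid e := by
  intro q h1 h2
  rcases Nat.lt_or_ge q mid with h3 | h3
  · exact (h μ).2 hμ q h1 h3
  · exact ⟨q, h3, h2, le_rfl⟩

/-- Invariant: on the original prefix the objective is dominated by its values on the part, up to
the current block `i`, of the segment of `2 ^ h` blocks containing `i`. At level 0 this part is a
single block. -/
theorem descend_runs {A B H k h₀ : ℕ} {X Y : ℕ → ℝ} {μ : ℝ} {s : State}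
    (hw : 4 * A + 8 < 2 ^ w) (hm : 2 * A + 1 < m) (hs : Loaded B H X Y s) (h6 : s.rreg 6 = μ)
    (hA : A = 2 ^ H * B) (hHB : H ≤ B) (h8 : s.nreg 8 = h₀) (h9 : s.nreg 9 = 2 ^ h₀)
    (hh : h₀ ≤ H) (h10 : s.nreg 10 = k) (hB : 0 < B) (hk : k < 2 * 2 ^ H) :
    Runs w m descend s (H * 60 + 20) fun s' => Frame descend s s' ∧
      ∃ k', s'.nreg 10 = k' ∧ k / 2 ^ h₀ * 2 ^ h₀ ≤ k' ∧ k' ≤ k ∧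
        Dominated X Y μ (k / 2 ^ h₀ * 2 ^ h₀ * B) ((k + 1) * B) (k' * B) ((k' + 1) * B) := by
  have hw0 := word_ne_zero hw
  have hHA : 2 ^ H ≤ A := hA ▸ Nat.le_mul_of_pos_right _ hB
  have hHlt : H < 2 ^ H := Nat.lt_two_pow_self
  have hT : ∀ h < H, h * (2 * 2 ^ H) + 2 * 2 ^ H ≤ 2 * A := by
    intro h hh
    have : (h + 1) * 2 ^ H ≤ B * 2 ^ H := Nat.mul_le_mul_right _ (by omega)
    rw [hA]; linarith
  refine Runs.frame ?_
  unfold descend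
  refine (Runs.loop (I := fun s' => ∃ h i, h ≤ h₀ ∧ s'.nreg 8 = h ∧ s'.nreg 9 = 2 ^ h ∧
      s'.nreg 10 = i ∧ i ≤ k ∧ k / 2 ^ h₀ * 2 ^ h₀ ≤ i / 2 ^ h * 2 ^ h ∧
      Dominated X Y μ (k / 2 ^ h₀ * 2 ^ h₀ * B) ((k + 1) * B) (i / 2 ^ h * 2 ^ h * B) ((i + 1) * B))
    (v := fun s' => s'.nreg 8) (V := H) (C := 50) ?_ ?_ ?_).mono ?_ ?_
  · exact ⟨h₀, k, le_rfl, h8, h9, h10, le_rfl, le_rfl, fun q h1 h2 => ⟨q, h1, h2, le_rfl⟩⟩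
  · omega
  · rintro s₁ hf ⟨h, i, hh₀, e8, e9, e10, hik, hbase, hdom⟩
    have e4 : s₁.nreg 4 = 2 * 2 ^ H := by rw [hf.n 4 (by decide), hs.num]
    have a4 : s₁.rarr 4 = s.rarr 4 := hf.a 4 (by decide)
    have a5 : s₁.rarr 5 = s.rarr 5 := hf.a 5 (by decide)
    have r6 : s₁.rreg 6 = μ := by rw [hf.r 6 (by decide), h6]
    refine ⟨by simp [e8]; omega, fun hlt => Runs.of_wp ?_ (by decide)⟩
    simp [e8] at hlt
    obtain ⟨h, rfl⟩ : ∃ h', h = h' + 1 := ⟨h - 1, by omega⟩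
    have hsucc : 2 ^ (h + 1) = 2 * 2 ^ h := pow_succ' _ _
    have hhalf : 2 ^ (h + 1) / 2 = 2 ^ h := by omega
    have hW : 0 < 2 ^ h := by positivity
    have hle : 2 ^ (h + 1) ≤ 2 ^ H := Nat.pow_le_pow_right (by norm_num) (by omega)
    have hqi : i / 2 ^ h ≤ i := Nat.div_le_self _ _
    have hqW : i / 2 ^ h * 2 ^ h ≤ i := Nat.div_mul_le_self _ _
    have hTh := hT h (by omega)
    have hdiv : i / 2 ^ (h + 1) = i / 2 ^ h / 2 := by
      rw [pow_succ, Nat.div_div_eq_div_mul]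
    have hilt : i < (i / 2 ^ h + 1) * 2 ^ h := by
      rw [Nat.add_mul, one_mul]; exact Nat.lt_div_mul_add hW
    rw [hdiv, hsucc] at hbase hdom
    obtain ⟨q, hq⟩ : ∃ q, i / 2 ^ h = q := ⟨_, rfl⟩
    simp [e8, e9, e10, e4, a4, a5, r6, hhalf, hw0]
    rw [hq] at hqi hqW hilt hbase hdom ⊢
    have hsep : q / 2 * 2 < q → Separates X Y (q / 2 * (2 * 2 ^ h) * B) (q * 2 ^ h * B) ((i + 1) * B)
        (s.rarr 4 (h * (2 * 2 ^ H) + i)) (s.rarr 5 (h * (2 * 2 ^ H) + i)) := by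
      intro hodd
      have hq2 : 2 * (q / 2) + 1 = q := by omega
      have hq3 : 2 * (q / 2) + 2 = q + 1 := by omega
      have := hs.good h (by omega) (q / 2) i (by rw [hq2]; exact hqW)
        (by rw [hq3]; exact hilt) (by omega)
      rw [hq2] at this
      rwa [show q / 2 * (2 * 2 ^ h) = 2 * (q / 2) * 2 ^ h by ring]
    have hbase' : q / 2 * (2 * 2 ^ h) ≤ q * 2 ^ h := by
      rw [show q / 2 * (2 * 2 ^ h) = q / 2 * 2 * 2 ^ h by ring]
      exact Nat.mul_le_mul_right _ (Nat.div_mul_le_self _ _)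
    and_intros <;> try omega
    · intro hodd hμ
      have hq1 : 1 ≤ q := by omega
      have hpos : 1 ≤ q * 2 ^ h := Nat.mul_pos hq1 hW
      -- `q` is odd, so block `q * 2 ^ h - 1` is the last one of the left half, and its quotient is
      -- `q - 1`. The new prefix is the entire left half.
      have hnew : (q * 2 ^ h - 1) / 2 ^ h = q / 2 * 2 := by
        have : (q - 1) * 2 ^ h + 2 ^ h = q * 2 ^ h := by
          rw [← Nat.succ_mul]; congr 1; omega
        rw [show q / 2 * 2 = q - 1 by omega]
        have hl : q * 2 ^ h - 1 < (q - 1 + 1) * 2 ^ h := by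
          rw [Nat.add_mul, one_mul]; omega
        exact Nat.div_eq_of_lt_le (by omega) hl
      rw [hnew]
      and_intros <;> try omega
      · rw [Nat.mul_assoc]
        exact hbase
      · rw [ Nat.sub_add_cancel hpos, Nat.mul_assoc (q / 2)]
        exact hdom.trans ((hsep hodd).dominated_left hμ)
    · intro hcase
      refine ⟨by omega, hik, hbase.trans hbase', hdom.trans ?_⟩
      -- The block stays the same for one of two reasons: the bridge favours the right half, or the
      -- prefix already lies within the left half and nothing is lost.
      rcases Nat.lt_or_ge (q / 2 * 2) q with hodd | heven
      · exact (hsep hodd).dominated_right (hcase hodd)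
      · have hq2 : q / 2 * 2 = q := le_antisymm (Nat.div_mul_le_self _ _) heven
        rw [← Nat.mul_assoc (q / 2), hq2]
        exact fun p h1 h2 => ⟨p, h1, h2, le_rfl⟩
  · simp [Test.cost, NExp.cost]; omega
  · rintro s' ⟨hf, ⟨h, i, hh₀, e8, e9, e10, hik, hbase, hdom⟩, hlt⟩
    simp [e8] at hlt
    subst hlt
    simp only [pow_zero, Nat.div_one, mul_one] at hbase hdom
    exact ⟨i, e10, by simpa using hbase, hik, by simpa using hdom⟩

/-- Descend in a segment whose level is given in registers 13 and 14, and scan the block found. -/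
def probe : Prog :=
  .seq (.setN 8 (.reg 13)) <| .seq (.setN 9 (.reg 14)) <| .seq descend scanBlock

/-- A hit anywhere in the prefix passes to a point of the scanned block with at least the same
objective value. That point is in the strip too, because `hX` puts the whole prefix there. -/
theorem probe_runs {A B H k h : ℕ} {X Y : ℕ → ℝ} {lo hi μ c : ℝ} {s : State}
    (hw : 4 * A + 8 < 2 ^ w) (hm : 2 * A + 1 < m) (hs : Loaded B H X Y s)
    (hl : Line lo hi μ c s)
    (hA : A = 2 ^ H * B) (hHB : H ≤ B) (h13 : s.nreg 13 = h) (h14 : s.nreg 14 = 2 ^ h)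
    (hh : h ≤ H) (h10 : s.nreg 10 = k) (hB : 0 < B) (hk : k < 2 * 2 ^ H)
    (hX : ∀ t, k / 2 ^ h * 2 ^ h * B ≤ t → t < (k + 1) * B → lo ≤ X t ∧ X t ≤ hi) :
    Runs w m probe s (H * 60 + B * 60 + 100) fun s' => Frame probe s s' ∧
      (s'.nreg 0 = 0 ↔ s.nreg 0 = 0 ∧
        ∀ t, k / 2 ^ h * 2 ^ h * B ≤ t → t < (k + 1) * B → ¬ Hit lo hi μ c X Y t) := by
  have hHA : 2 ^ H ≤ A := hA ▸ Nat.le_mul_of_pos_right _ hB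
  have hHlt : H < 2 ^ H := Nat.lt_two_pow_self
  have hle : 2 ^ h ≤ 2 ^ H := Nat.pow_le_pow_right (by norm_num) hh
  refine Runs.frame ?_
  unfold probe
  refine Runs.mono (T := 2 + (2 + (H * 60 + 20 + (B * 60 + 40)))) ?_ (by omega) (fun _ h => h)
  refine Runs.seq (Runs.of_wp ⟨by simp [*]; omega, ?_⟩ (by decide))
  refine Runs.seq (Runs.of_wp ⟨by simp [*]; omega, ?_⟩ (by decide))
  refine Runs.seq ((descend_runs (A := A) (H := H) (B := B) (X := X) (Y := Y) (k := k) (h₀ := h)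
    (μ := μ) hw hm
    ⟨by simp [hs.len], by simp [hs.num], by simp [hs.xs], by simp [hs.ys], by simpa using hs.good⟩
    (by simp [hl.slope]) hA hHB (by simp [h13]) (by simp [h14]) hh (by simp [h10]) hB hk).mono
    le_rfl ?_)
  rintro s₁ ⟨hf, k', e10, hk1, hk2, hdom⟩
  have hs₁ : Loaded B H X Y s₁ := Loaded.frame (s := (s.setN 8 _).setN 9 _)
    ⟨by simp [hs.len], by simp [hs.num], by simp [hs.xs], by simp [hs.ys], by simpa using hs.good⟩
    hf (by decide) (by decide) (by decide)
  have hl₁ : Line lo hi μ c s₁ := Line.frame (s := (s.setN 8 _).setN 9 _)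
    ⟨by simp [hl.lo], by simp [hl.hi], by simp [hl.slope], by simp [hl.icept]⟩ hf (by decide)
  have hkB : (k' + 1) * B ≤ (k + 1) * B := Nat.mul_le_mul_right _ (by omega)
  have hbB : k / 2 ^ h * 2 ^ h * B ≤ k' * B := Nat.mul_le_mul_right _ hk1
  have hkA : (k + 1) * B ≤ 2 * A := by
    rw [hA, ← Nat.mul_assoc]
    exact Nat.mul_le_mul_right _ (by omega)
  refine (scanBlock_runs hw hm hs₁ hl₁ e10 hB (by omega)).mono le_rfl ?_
  rintro s₂ ⟨hf₂, h0⟩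
  rw [h0, hf.n 0 (by decide)]
  simp only [State.setN_nreg]
  refine and_congr (by simp) ⟨fun hno t h1 h2 hit => ?_, fun hno t h1 h2 => hno t (by omega) (by omega)⟩
  obtain ⟨p, hp1, hp2, hp3⟩ := hdom t h1 h2
  obtain ⟨hp4, hp5⟩ := hX p (by omega) (by omega)
  exact hno p hp1 hp2 ⟨hp4, hp5, hit.2.2.trans_le hp3⟩

/-! ### Splitting a range of blocks -/

/-- Find the level (registers 13 and 14) at which the blocks strictly between those in registers 11
and 12 split into a suffix of one segment and a prefix of the next one. -/
def splitLevel : Prog :=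
  .seq (.setN 13 (.const 0)) <| .seq (.setN 14 (.const 1)) <|
  .seq (.loop (.not (.eqN (.div (.add (.reg 11) (.const 1)) (.reg 14))
      (.div (.sub (.reg 12) (.const 1)) (.reg 14))))
    (.seq (.setN 13 (.add (.reg 13) (.const 1))) (.setN 14 (.mul (.const 2) (.reg 14))))) <|
  .branch (.ltN (.const 0) (.reg 13))
    (.seq (.setN 13 (.sub (.reg 13) (.const 1))) (.setN 14 (.div (.reg 14) (.const 2)))) .skip

/-- Climb until the first and the last block share a segment, then step back one level: they lie in
the two children of that segment. A single block needs no split, and the level stays 0. -/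
theorem splitLevel_runs {A H i j : ℕ} {s : State}
    (hw : 4 * A + 8 < 2 ^ w) (hA : 2 ^ H ≤ A) (h11 : s.nreg 11 = i) (h12 : s.nreg 12 = j)
    (hij : i + 1 < j) (hj : j < 2 ^ H) :
    Runs w m splitLevel s (H * 40 + 80) fun s' => Frame splitLevel s s' ∧
      ∃ h ≤ H, s'.nreg 13 = h ∧ s'.nreg 14 = 2 ^ h ∧
        ((i + 1 = j - 1 ∧ h = 0) ∨ (j - 1) / 2 ^ h = (i + 1) / 2 ^ h + 1) := by
  have hw0 := word_ne_zero hw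
  have hHlt : H < 2 ^ H := Nat.lt_two_pow_self
  refine Runs.frame ?_
  unfold splitLevel
  refine Runs.mono (T := 2 + (2 + (H * 40 + 30 + 20))) ?_ (by omega) (fun _ h => h)
  refine Runs.seq (Runs.of_wp ⟨by simp, ?_⟩ (by decide))
  refine Runs.seq (Runs.of_wp ⟨by simp [hw0], ?_⟩ (by decide))
  refine Runs.seq ((Runs.loop (I := fun s' => ∃ h ≤ H, s'.nreg 13 = h ∧ s'.nreg 14 = 2 ^ h ∧
      ∀ h', h = h' + 1 → (i + 1) / 2 ^ h' ≠ (j - 1) / 2 ^ h')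
    (v := fun s' => H - s'.nreg 13) (V := H) (C := 20) ?_ ?_ ?_).mono ?_ ?_)
  · exact ⟨0, by simp⟩
  · simp
  · rintro s₁ hf ⟨h, hh, e13, e14, hne⟩
    have e11 : s₁.nreg 11 = i := by rw [hf.n 11 (by decide)]; simp [h11]
    have e12 : s₁.nreg 12 = j := by rw [hf.n 12 (by decide)]; simp [h12]
    have hle : 2 ^ h ≤ 2 ^ H := Nat.pow_le_pow_right (by norm_num) hh
    have hpos : 2 ^ h ≠ 0 := by positivity
    refine ⟨by simp [*]; omega, fun hlt => Runs.of_wp ?_ (by decide)⟩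
    simp [e11, e12, e14] at hlt
    -- At level `H` both quotients vanish, since both blocks are below `2 ^ H`; the loop stops there
    -- at the latest.
    have hhH : h < H := by
      rcases hh.lt_or_eq with h1 | rfl
      · exact h1
      · exact absurd (by rw [Nat.div_eq_of_lt (by omega), Nat.div_eq_of_lt (by omega)]) hlt
    have hle' : 2 ^ (h + 1) ≤ 2 ^ H := Nat.pow_le_pow_right (by norm_num) hhH
    have hsucc : 2 ^ (h + 1) = 2 * 2 ^ h := pow_succ' _ _
    simp [e13, e14, hw0]
    and_intros <;> try omega
  · simp [Test.cost, NExp.cost]; omega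
  rintro s₁ ⟨hf, ⟨h, hh, e13, e14, hne⟩, heq⟩
  have e11 : s₁.nreg 11 = i := by rw [hf.n 11 (by decide)]; simp [h11]
  have e12 : s₁.nreg 12 = j := by rw [hf.n 12 (by decide)]; simp [h12]
  simp [e11, e12, e14] at heq
  refine Runs.of_wp ?_ (by decide)
  have hle : 2 ^ h ≤ 2 ^ H := Nat.pow_le_pow_right (by norm_num) hh
  rcases h with _ | h
  · simp [e13, e14, hw0]
    simp at heq
    omega
  · have hsucc : 2 ^ (h + 1) = 2 ^ h * 2 := pow_succ _ _
    have hhalf : 2 ^ (h + 1) / 2 = 2 ^ h := by omega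
    simp [e13, e14, hw0, hhalf]
    -- The quotients at level `h` differ but have the same half, so they are consecutive.
    rw [hsucc, ← Nat.div_div_eq_div_mul, ← Nat.div_div_eq_div_mul] at heq
    have hne' := hne h rfl
    have hmono : (i + 1) / 2 ^ h ≤ (j - 1) / 2 ^ h := Nat.div_le_div_right (by omega)
    and_intros <;> try omega

/-! ### Reflection at the vertical axis -/

/-- `A` points sorted by their first coordinates, followed by their mirror image, in blocks of
length `B`. -/
structure Mirrored (A B H : ℕ) (X Y : ℕ → ℝ) : Prop where
  size : A = 2 ^ H * B
  pos : 0 < B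
  le : H ≤ B
  sorted : ∀ u v, u ≤ v → v < A → X u ≤ X v
  mirror : ∀ t < A, X (2 * A - (t + 1)) = - X t ∧ Y (2 * A - (t + 1)) = Y t

/-- No point with index in `[a, b)` lies in the strip above the line. -/
def NoHit (lo hi μ c : ℝ) (X Y : ℕ → ℝ) (a b : ℕ) : Prop :=
  ∀ t, a ≤ t → t < b → ¬ Hit lo hi μ c X Y t

/-- Negating both slope and first coordinate leaves `Y - μ * X`, and hence the intercept, unchanged.
The strip is negated and its ends are exchanged. -/
theorem Mirrored.noHit {A B H : ℕ} {X Y : ℕ → ℝ} (h : Mirrored A B H X Y) {lo hi μ c : ℝ} {a b : ℕ}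
    (hb : b ≤ A) : NoHit (-hi) (-lo) (-μ) c X Y (2 * A - b) (2 * A - a) ↔
      NoHit lo hi μ c X Y a b := by
  have key : ∀ t < A, (Hit (-hi) (-lo) (-μ) c X Y (2 * A - (t + 1)) ↔ Hit lo hi μ c X Y t) := by
    intro t ht
    obtain ⟨h1, h2⟩ := h.mirror t ht
    rw [Hit, Hit, h1, h2, neg_le_neg_iff, neg_le_neg_iff, neg_mul_neg]
    tauto
  constructor
  · intro hno t h1 h2
    rw [← key t (by omega)]
    exact hno _ (by omega) (by omega)
  · intro hno t h1 h2
    have := hno (2 * A - (t + 1)) (by omega) (by omega)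
    rwa [← key _ (by omega), show 2 * A - (2 * A - (t + 1) + 1) = t by omega] at this

/-- The reflection maps aligned segments to aligned segments, so the start of the image segment is
the mirror of the end of the segment of `u`. Thus a suffix starting at `u` becomes a prefix ending
at the image of `u`. -/
theorem mirror_div_mul {M W u : ℕ} (hW : 0 < W) (hu : u < M * W) :
    (M * W - (u + 1)) / W * W = M * W - (u / W + 1) * W := by
  have hq : u / W < M := (Nat.div_lt_iff_lt_mul hW).2 hu
  have h1 : u / W * W ≤ u := Nat.div_mul_le_self _ _
  have h2 : u < u / W * W + W := Nat.lt_div_mul_add hW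
  have h3 : (M - (u / W + 1)) * W = M * W - (u / W + 1) * W := Nat.sub_mul _ _ _
  have h4 : (u / W + 1) * W ≤ M * W := Nat.mul_le_mul_right _ hq
  have h5 : (u / W + 1) * W = u / W * W + W := by ring
  rw [← h3]
  congr 1
  have h6 : M * W - (u + 1) < (M - (u / W + 1) + 1) * W := by
    rw [Nat.add_mul, h3]; omega
  exact Nat.div_eq_of_lt_le (by omega) h6

/-- Reflect the strip and the line at the vertical axis. -/
def flipLine : Prog :=
  .seq (.setR 8 (.sub (.const 0) (.reg 5))) <| .seq (.setR 5 (.sub (.const 0) (.reg 4))) <|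
  .seq (.setR 4 (.reg 8)) <| .setR 6 (.sub (.const 0) (.reg 6))

theorem flipLine_runs {lo hi μ c : ℝ} {s : State} (hl : Line lo hi μ c s) :
    Runs w m flipLine s 20 fun s' => Frame flipLine s s' ∧ Line (-hi) (-lo) (-μ) c s' := by
  refine Runs.frame (Runs.of_wp ?_ (by decide))
  simp [flipLine]
  exact ⟨by simp [hl.hi], by simp [hl.lo], by simp [hl.slope], by simp [hl.icept]⟩

/-! ### The ends of the strip -/

/-- Scan the block with the lower end of the strip. -/
def visit : Prog := .seq locateBlock scanBlock

theorem visit_runs {A B H k : ℕ} {X Y : ℕ → ℝ} {lo hi μ c : ℝ} {s : State}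
    (hw : 4 * A + 8 < 2 ^ w) (hm : 2 * A + 1 < m) (hs : Loaded B H X Y s)
    (hl : Line lo hi μ c s) (hA : A = 2 ^ H * B) (h10 : s.nreg 10 = k) (hB : 0 < B)
    (hk : k ≤ 2 ^ H) :
    Runs w m visit s (H * 40 + B * 60 + 80) fun s' => Frame visit s s' ∧
      ∃ i, s'.nreg 10 = i ∧ k ≤ i ∧ i < k + 2 ^ H ∧ (i = k ∨ X (i * B - 1) < lo) ∧
        (i + 1 = k + 2 ^ H ∨ lo ≤ X ((i + 1) * B - 1)) ∧
        (s'.nreg 0 = 0 ↔ s.nreg 0 = 0 ∧ NoHit lo hi μ c X Y (i * B) ((i + 1) * B)) := by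
  refine Runs.frame ?_
  unfold visit
  refine Runs.mono (T := H * 40 + 40 + (B * 60 + 40)) ?_ (by omega) (fun _ h => h)
  refine Runs.seq ((locateBlock_runs hw hm hs hA h10 hB hk).mono le_rfl ?_)
  rintro s₁ ⟨hf, i, e10, h1, h2, h3, h4⟩
  have hiA : (i + 1) * B ≤ 2 * A := by
    rw [hA, ← Nat.mul_assoc]
    exact Nat.mul_le_mul_right _ (by omega)
  refine (scanBlock_runs hw hm (hs.frame hf (by decide) (by decide) (by decide))
    (hl.frame hf (by decide)) e10 hB hiA).mono le_rfl ?_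
  rintro s₂ ⟨hf₂, h0⟩
  rw [hl.lo] at h3 h4
  rw [hf.n 0 (by decide)] at h0
  exact ⟨i, by rw [hf₂.n 10 (by decide), e10], h1, h2, h3, h4, h0⟩

/-- Scan the blocks (registers 11 and 12) that contain the ends of the strip. -/
def scanEnds : Prog :=
  .seq (.setN 0 (.const 0)) <| .seq (.setN 10 (.const 0)) <| .seq visit <|
  .seq (.setN 11 (.reg 10)) <| .seq flipLine <| .seq (.setN 10 (.div (.reg 4) (.const 2))) <|
  .seq visit <| .setN 12 (.sub (.reg 4) (.add (.reg 10) (.const 1)))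

theorem Loaded.setN {B H i v : ℕ} {X Y : ℕ → ℝ} {s : State} (h : Loaded B H X Y s) (h3 : i ≠ 3)
    (h4 : i ≠ 4) : Loaded B H X Y (s.setN i v) :=
  ⟨by simp [h.len, h3.symm], by simp [h.num, h4.symm], by simp [h.xs], by simp [h.ys],
    by simpa using h.good⟩

theorem Line.setN {lo hi μ c : ℝ} {i v : ℕ} {s : State} (h : Line lo hi μ c s) :
    Line lo hi μ c (s.setN i v) :=
  ⟨by simp [h.lo], by simp [h.hi], by simp [h.slope], by simp [h.icept]⟩

/-- The blocks `i` and `j` contain the ends of the strip `[lo, hi]`. -/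
structure Ends (B H : ℕ) (X : ℕ → ℝ) (lo hi : ℝ) (i j : ℕ) : Prop where
  lt : i < 2 ^ H
  lt' : j < 2 ^ H
  before : i = 0 ∨ X (i * B - 1) < lo
  inside : i + 1 = 2 ^ H ∨ lo ≤ X ((i + 1) * B - 1)
  inside' : j = 0 ∨ X (j * B) ≤ hi
  after : j + 1 = 2 ^ H ∨ hi < X ((j + 1) * B)

/-- The upper end of the strip is the lower end of the reflected strip, so the same search, run in
the mirrored copy, finds it. The line is left reflected for the next stage. -/
theorem scanEnds_runs {A B H : ℕ} {X Y : ℕ → ℝ} {lo hi μ c : ℝ} {s : State}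
    (hw : 4 * A + 8 < 2 ^ w) (hm : 2 * A + 1 < m) (hs : Loaded B H X Y s)
    (hl : Line lo hi μ c s) (hM : Mirrored A B H X Y) :
    Runs w m scanEnds s (H * 80 + B * 120 + 240) fun s' => Frame scanEnds s s' ∧
      Line (-hi) (-lo) (-μ) c s' ∧ ∃ i j, s'.nreg 11 = i ∧ s'.nreg 12 = j ∧ Ends B H X lo hi i j ∧
        (s'.nreg 0 = 0 ↔ NoHit lo hi μ c X Y (i * B) ((i + 1) * B) ∧
          NoHit lo hi μ c X Y (j * B) ((j + 1) * B)) := by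
  have hw0 := word_ne_zero hw
  have hA := hM.size
  have hB := hM.pos
  have hHA : 2 ^ H ≤ A := hA ▸ Nat.le_mul_of_pos_right _ hB
  refine Runs.frame ?_
  unfold scanEnds
  refine Runs.mono (T := 2 + (2 + (H * 40 + B * 60 + 80 + (2 + (20 + (6 +
    (H * 40 + B * 60 + 80 + 10))))))) ?_ (by omega) (fun _ h => h)
  refine Runs.seq (Runs.of_wp ⟨by simp, ?_⟩ (by decide))
  refine Runs.seq (Runs.of_wp ⟨by simp, ?_⟩ (by decide))
  refine Runs.seq ((visit_runs hw hm ((hs.setN (by decide) (by decide)).setN (by decide)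
    (by decide)) hl.setN.setN hA (k := 0) (by simp) hB (Nat.zero_le _)).mono le_rfl ?_)
  rintro s₁ ⟨hf₁, i, e10, -, hi1, hi2, hi3, hi4⟩
  have hs₁ : Loaded B H X Y s₁ := Loaded.frame ((hs.setN (by decide) (by decide)).setN (by decide)
    (by decide)) hf₁ (by decide) (by decide) (by decide)
  have hl₁ : Line lo hi μ c s₁ := Line.frame hl.setN.setN hf₁ (by decide)
  simp only [zero_add] at hi1 hi3
  refine Runs.seq (Runs.of_wp ⟨by simp [e10]; omega, ?_⟩ (by decide))
  refine Runs.seq ((flipLine_runs hl₁.setN).mono le_rfl ?_)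
  rintro s₂ ⟨hf₂, hl₂⟩
  have hs₂ : Loaded B H X Y s₂ := Loaded.frame (hs₁.setN (by decide) (by decide)) hf₂
    (by decide) (by decide) (by decide)
  have e11 : s₂.nreg 11 = i := by rw [hf₂.n 11 (by decide)]; simp [e10]
  have e0 : s₂.nreg 0 = s₁.nreg 0 := by rw [hf₂.n 0 (by decide)]; simp
  refine Runs.seq (Runs.of_wp ⟨by simp [hs₂.num]; omega, ?_⟩ (by decide))
  refine Runs.seq ((visit_runs hw hm (hs₂.setN (by decide) (by decide)) hl₂.setN hA (k := 2 ^ H)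
    (by simp [hs₂.num]) hB le_rfl).mono le_rfl ?_)
  rintro s₃ ⟨hf₃, j', e10', hj0, hj1, hj2, hj3, hj4⟩
  have hl₃ : Line (-hi) (-lo) (-μ) c s₃ := Line.frame hl₂.setN hf₃ (by decide)
  have hn4 : s₃.nreg 4 = 2 * 2 ^ H := by rw [hf₃.n 4 (by decide)]; simp [hs₂.num]
  have hn11 : s₃.nreg 11 = i := by rw [hf₃.n 11 (by decide)]; simp [e11]
  -- Block `j'` of the second copy is the image of block `j = 2 * 2 ^ H - (j' + 1)` of the first.
  obtain ⟨j, hj, rfl⟩ : ∃ j, j < 2 ^ H ∧ j' = 2 * 2 ^ H - (j + 1) :=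
    ⟨2 * 2 ^ H - (j' + 1), by omega, by omega⟩
  have hjA : (j + 1) * B ≤ A := by
    rw [hA]
    exact Nat.mul_le_mul_right _ (by omega)
  have hexp : (j + 1) * B = j * B + B := by ring
  have ej : (2 * 2 ^ H - (j + 1)) * B = 2 * A - (j + 1) * B := by
    rw [Nat.sub_mul, hA, Nat.mul_assoc]
  have ej' : (2 * 2 ^ H - (j + 1) + 1) * B = 2 * A - j * B := by
    rw [show 2 * 2 ^ H - (j + 1) + 1 = 2 * 2 ^ H - j by omega, Nat.sub_mul, hA, Nat.mul_assoc]
  rw [ej, ej', hM.noHit hjA] at hj4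
  rw [ej] at hj2
  rw [ej'] at hj3
  refine Runs.of_wp ⟨by simp [e10', hn4, hw0]; omega, hl₃.setN, i, j, by simp [hn11],
    by simp [e10', hn4]; omega, ⟨hi1, hj, hi2, hi3, ?_, ?_⟩, ?_⟩ (by decide)
  · rcases hj3 with h | h
    · left; omega
    · right
      rw [show 2 * A - j * B - 1 = 2 * A - (j * B + 1) by omega,
        (hM.mirror _ (by omega)).1] at h
      linarith
  · rcases hj2 with h | h
    · left; omega
    · by_cases hjl : j + 1 = 2 ^ H
      · exact .inl hjl
      · right
        have hlt : (j + 1) * B < A := by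
          rw [hA]
          exact Nat.mul_lt_mul_of_pos_right (by omega) hB
        rw [show 2 * A - (j + 1) * B - 1 = 2 * A - ((j + 1) * B + 1) by omega,
          (hM.mirror _ hlt).1] at h
        linarith
  · simp only [State.setN_nreg] at hj4 hi4 ⊢
    simp at hj4 hi4 ⊢
    rw [hj4, e0, hi4]

/-! ### The interior of the strip -/

/-- Probe the blocks strictly between those in registers 11 and 12, starting with the reflected
strip. -/
def scanMiddle : Prog :=
  .seq splitLevel <| .seq (.setN 10 (.sub (.reg 4) (.add (.reg 11) (.const 2)))) <|
  .seq probe <| .seq flipLine <| .seq (.setN 10 (.sub (.reg 12) (.const 1))) probe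

/-- All blocks strictly between `i` and `j` are inside the strip, as `probe_runs` requires. The
suffix starting at block `i + 1` is probed as a prefix in the mirrored copy; after reflecting back,
the prefix ending at block `j - 1` is probed in the original. -/
theorem scanMiddle_runs {A B H i j : ℕ} {X Y : ℕ → ℝ} {lo hi μ c : ℝ} {s : State}
    (hw : 4 * A + 8 < 2 ^ w) (hm : 2 * A + 1 < m) (hs : Loaded B H X Y s)
    (hl : Line (-hi) (-lo) (-μ) c s) (hM : Mirrored A B H X Y) (he : Ends B H X lo hi i j)
    (h11 : s.nreg 11 = i) (h12 : s.nreg 12 = j) (hij : i + 1 < j) :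
    Runs w m scanMiddle s (H * 160 + B * 120 + 400) fun s' => Frame scanMiddle s s' ∧
      (s'.nreg 0 = 0 ↔ s.nreg 0 = 0 ∧ NoHit lo hi μ c X Y ((i + 1) * B) (j * B)) := by
  have hw0 := word_ne_zero hw
  have hA := hM.size
  have hB := hM.pos
  have hHA : 2 ^ H ≤ A := hA ▸ Nat.le_mul_of_pos_right _ hB
  have hi' := he.lt
  have hj' := he.lt'
  have hjA : j * B ≤ A := by
    rw [hA]
    exact Nat.mul_le_mul_right _ (by omega)
  have hX : ∀ t, (i + 1) * B ≤ t → t < j * B → lo ≤ X t ∧ X t ≤ hi := by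
    intro t h1 h2
    constructor
    · rcases he.inside with h | h
      · omega
      · exact h.trans (hM.sorted _ _ (by omega) (by omega))
    · rcases he.inside' with h | h
      · omega
      · refine (hM.sorted _ _ h2.le ?_).trans h
        rw [hA]
        exact Nat.mul_lt_mul_of_pos_right hj' hB
  refine Runs.frame ?_
  unfold scanMiddle
  refine Runs.mono (T := H * 40 + 80 + (6 + (H * 60 + B * 60 + 100 + (20 + (6 +
    (H * 60 + B * 60 + 100)))))) ?_ (by omega) (fun _ h => h)
  refine Runs.seq ((splitLevel_runs hw hHA h11 h12 hij hj').mono le_rfl ?_)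
  rintro s₁ ⟨hf₁, h, hh, e13, e14, hsplit⟩
  have hs₁ : Loaded B H X Y s₁ := hs.frame hf₁ (by decide) (by decide) (by decide)
  have hl₁ : Line (-hi) (-lo) (-μ) c s₁ := hl.frame hf₁ (by decide)
  have e11 : s₁.nreg 11 = i := by rw [hf₁.n 11 (by decide), h11]
  have e12 : s₁.nreg 12 = j := by rw [hf₁.n 12 (by decide), h12]
  have e0 : s₁.nreg 0 = s.nreg 0 := hf₁.n 0 (by decide)
  set W := 2 ^ h with hWdef
  have hW : 0 < W := by positivity
  have hMW : 2 * 2 ^ H = (2 * 2 ^ (H - h)) * W := by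
    rw [hWdef, Nat.mul_assoc, ← pow_add, Nat.sub_add_cancel hh]
  have hbase : (2 * 2 ^ H - (i + 1 + 1)) / W * W = 2 * 2 ^ H - ((i + 1) / W + 1) * W := by
    rw [hMW]
    exact mirror_div_mul hW (by omega)
  -- The suffix ends no later than block `j` starts, the prefix starts after block `i`, and there is
  -- no gap between them. For a single interior block, suffix and prefix coincide.
  have hmid : ((i + 1) / W + 1) * W ≤ j := by
    rcases hsplit with ⟨h1, rfl⟩ | h1
    · simp [hWdef]; omega
    · rw [← h1]
      exact (Nat.div_mul_le_self _ _).trans (by omega)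
  have hmid' : i + 1 ≤ (j - 1) / W * W := by
    rcases hsplit with ⟨h1, rfl⟩ | h1
    · simp [hWdef]; omega
    · rw [h1, Nat.add_mul, one_mul]
      exact (Nat.lt_div_mul_add hW).le
  have hcover : (j - 1) / W * W ≤ ((i + 1) / W + 1) * W := by
    rcases hsplit with ⟨h1, rfl⟩ | h1
    · simp [hWdef]; omega
    · rw [h1]
  have hmidB := Nat.mul_le_mul_right B hmid
  have hmidB' := Nat.mul_le_mul_right B hmid'
  have hcoverB := Nat.mul_le_mul_right B hcover
  have eb : (2 * 2 ^ H - (i + 1 + 1)) / W * W * B = 2 * A - ((i + 1) / W + 1) * W * B := by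
    rw [hbase, Nat.sub_mul, hA, Nat.mul_assoc 2]
  have ee : (2 * 2 ^ H - (i + 1 + 1) + 1) * B = 2 * A - (i + 1) * B := by
    rw [show 2 * 2 ^ H - (i + 1 + 1) + 1 = 2 * 2 ^ H - (i + 1) by omega, Nat.sub_mul, hA,
      Nat.mul_assoc]
  refine Runs.seq (Runs.of_wp ⟨by simp [hs₁.num, e11]; omega, ?_⟩ (by decide))
  refine Runs.seq ((probe_runs hw hm (hs₁.setN (by decide) (by decide)) hl₁.setN hA hM.le
    (h := h) (by simp [e13]) (by simp [e14, hWdef]) hh (k := 2 * 2 ^ H - (i + 1 + 1))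
    (by simp [hs₁.num, e11]) hB (by omega) ?_).mono le_rfl ?_)
  · rw [← hWdef, eb, ee]
    intro t h1 h2
    obtain ⟨h3, h4⟩ := hX (2 * A - (t + 1)) (by omega) (by omega)
    have h5 := (hM.mirror (2 * A - (t + 1)) (by omega)).1
    rw [show 2 * A - (2 * A - (t + 1) + 1) = t by omega] at h5
    rw [h5]
    exact ⟨neg_le_neg h4, neg_le_neg h3⟩
  rw [← hWdef, eb, ee]
  rintro s₂ ⟨hf₂, hno₂⟩
  have hs₂ : Loaded B H X Y s₂ := Loaded.frame (hs₁.setN (by decide) (by decide)) hf₂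
    (by decide) (by decide) (by decide)
  have hl₂ : Line (-hi) (-lo) (-μ) c s₂ := Line.frame hl₁.setN hf₂ (by decide)
  replace hno₂ : s₂.nreg 0 = 0 ↔ s₁.nreg 0 = 0 ∧
      NoHit lo hi μ c X Y ((i + 1) * B) (((i + 1) / W + 1) * W * B) := by
    rw [← hM.noHit (by omega)]
    simpa [NoHit] using hno₂
  refine Runs.seq ((flipLine_runs hl₂).mono le_rfl ?_)
  rintro s₃ ⟨hf₃, hl₃⟩
  simp only [neg_neg] at hl₃
  have hs₃ : Loaded B H X Y s₃ := hs₂.frame hf₃ (by decide) (by decide) (by decide)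
  have n12 : s₃.nreg 12 = j := by
    rw [hf₃.n 12 (by decide), hf₂.n 12 (by decide)]; simp [e12]
  have n13 : s₃.nreg 13 = h := by
    rw [hf₃.n 13 (by decide), hf₂.n 13 (by decide)]; simp [e13]
  have n14 : s₃.nreg 14 = W := by
    rw [hf₃.n 14 (by decide), hf₂.n 14 (by decide)]; simp [e14]
  have n0 : s₃.nreg 0 = s₂.nreg 0 := hf₃.n 0 (by decide)
  have ej : j - 1 + 1 = j := by omega
  refine Runs.seq (Runs.of_wp ⟨by simp [n12, hw0]; omega, ?_⟩ (by decide))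
  refine (probe_runs hw hm (hs₃.setN (by decide) (by decide)) hl₃.setN hA hM.le
    (h := h) (by simp [n13]) (by simp [n14, hWdef]) hh (k := j - 1)
    (by simp [n12]) hB (by omega) ?_).mono le_rfl ?_
  · rw [← hWdef, ej]
    intro t h1 h2
    exact hX t (by omega) h2
  rw [← hWdef, ej]
  rintro s₄ ⟨hf₄, hno₄⟩
  rw [hno₄]
  simp only [State.setN_nreg]
  simp only [show (0 : ℕ) ≠ 10 by decide, if_false]
  rw [n0, hno₂, e0, and_assoc]
  refine and_congr Iff.rfl ⟨fun ⟨h1, h2⟩ t h3 h4 => ?_,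
    fun h1 => ⟨fun t h3 h4 => h1 t h3 (by omega), fun t h3 h4 => h1 t (by omega) h4⟩⟩
  rcases Nat.lt_or_ge t (((i + 1) / W + 1) * W * B) with h5 | h5
  · exact h1 t h3 h5
  · exact h2 t (by omega) h4

/-! ### The complete query -/

/-- Compute the strip and the line of a query from its end-points. -/
def setLine : Prog :=
  .seq (.branch (.ltR (.reg 0) (.reg 2)) (.seq (.setR 4 (.reg 0)) (.setR 5 (.reg 2)))
    (.seq (.setR 4 (.reg 2)) (.setR 5 (.reg 0)))) <|
  .seq (.setR 6 (.div (.sub (.reg 3) (.reg 1)) (.sub (.reg 2) (.reg 0)))) <|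
  .setR 7 (.sub (.reg 1) (.mul (.reg 6) (.reg 0)))

theorem setLine_runs (s : State) {a b : ℝ × ℝ} (hab : a.1 ≠ b.1) (h0 : s.rreg 0 = a.1)
    (h1 : s.rreg 1 = a.2) (h2 : s.rreg 2 = b.1) (h3 : s.rreg 3 = b.2) :
    Runs w m setLine s 40 fun s' => Frame setLine s s' ∧
      Line (min a.1 b.1) (max a.1 b.1) ((b.2 - a.2) / (b.1 - a.1))
        (a.2 - (b.2 - a.2) / (b.1 - a.1) * a.1) s' := by
  refine Runs.frame (Runs.of_wp ?_ (by decide))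
  have hne : b.1 - a.1 ≠ 0 := sub_ne_zero.2 hab.symm
  simp only [setLine, Prog.wp, Test.Ok, Test.Holds, RExp.Ok, RExp.val, State.setR_rreg]
  simp [h0, h1, h2, h3, hne]
  exact ⟨fun hlt => ⟨by simp [hlt.le], by simp [hlt.le], by simp, by simp⟩,
    fun hle => ⟨by simp [hle], by simp [hle], by simp, by simp⟩⟩

/-- Answer a query. -/
def query : Prog :=
  .branch (.eqN (.reg 6) (.const 0)) (.setN 0 (.const 0)) <|
  .seq setLine <| .seq scanEnds <|
  .branch (.ltN (.add (.reg 11) (.const 1)) (.reg 12)) scanMiddle .skip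

/-- By sortedness a hit has its index in or after block `i` and in or before block `j`. It is
therefore in one of these two blocks or, when `i + 1 < j`, in the interior. -/
theorem query_runs {A B H : ℕ} {X Y : ℕ → ℝ} {s : State} {a b : ℝ × ℝ} (hab : a.1 ≠ b.1)
    (hw : 4 * A + 8 < 2 ^ w) (hm : 2 * A + 1 < m) (hs : Loaded B H X Y s)
    (hM : Mirrored A B H X Y) (h6 : s.nreg 6 ≠ 0) (h6' : s.nreg 6 ≤ A) :
    Runs w m query (poseQuery s a b) (H * 240 + B * 240 + 800) fun s' =>
      Frame query (poseQuery s a b) s' ∧ (s'.nreg 0 = 0 ↔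
        NoHit (min a.1 b.1) (max a.1 b.1) ((b.2 - a.2) / (b.1 - a.1))
          (a.2 - (b.2 - a.2) / (b.1 - a.1) * a.1) X Y 0 A) := by
  have hw0 := word_ne_zero hw
  have hA := hM.size
  have hB := hM.pos
  have hHA : 2 ^ H ≤ A := hA ▸ Nat.le_mul_of_pos_right _ hB
  generalize hlo : min a.1 b.1 = lo
  generalize hhi : max a.1 b.1 = hi
  generalize hμ : (b.2 - a.2) / (b.1 - a.1) = μ
  generalize hc : a.2 - μ * a.1 = c
  refine Runs.frame ?_
  unfold query
  refine Runs.mono (T := 3 + (40 + (H * 80 + B * 120 + 240 +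
    (5 + (H * 160 + B * 120 + 400) + 1))) + 1) ?_ (by omega) (fun _ h => h)
  refine Runs.branch (by simp [poseQuery]; omega) (fun h => absurd h (by simpa [poseQuery] using h6))
    fun _ => ?_
  refine Runs.seq ((setLine_runs _ hab (by simp [poseQuery]) (by simp [poseQuery])
    (by simp [poseQuery]) (by simp [poseQuery])).mono le_rfl ?_)
  rw [hμ, hlo, hhi, hc]
  rintro s₁ ⟨hf₁, hl₁⟩
  have hs₁ : Loaded B H X Y s₁ := Loaded.frame (s := poseQuery s a b)
    ⟨by simp [poseQuery, hs.len], by simp [poseQuery, hs.num], by simp [poseQuery, hs.xs],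
      by simp [poseQuery, hs.ys], by simpa [poseQuery] using hs.good⟩ hf₁
    (by decide) (by decide) (by decide)
  refine Runs.seq ((scanEnds_runs hw hm hs₁ hl₁ hM).mono le_rfl ?_)
  rintro s₂ ⟨hf₂, hl₂, i, j, e11, e12, he, hno⟩
  have hs₂ : Loaded B H X Y s₂ := hs₁.frame hf₂ (by decide) (by decide) (by decide)
  have hi' := he.lt
  have hj' := he.lt'
  have hiA : (i + 1) * B ≤ A := hA ▸ Nat.mul_le_mul_right _ hi'
  have hjA : (j + 1) * B ≤ A := hA ▸ Nat.mul_le_mul_right _ hj'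
  have hiexp : (i + 1) * B = i * B + B := by ring
  have hjexp : (j + 1) * B = j * B + B := by ring
  have hlow : ∀ t < A, Hit lo hi μ c X Y t → i * B ≤ t := by
    intro t ht hit
    by_contra hlt
    rcases he.before with rfl | h
    · omega
    · exact absurd (hit.1.trans (hM.sorted t (i * B - 1) (by omega) (by omega))) (not_le.2 h)
  have hhigh : ∀ t < A, Hit lo hi μ c X Y t → t < (j + 1) * B := by
    intro t ht hit
    by_contra hlt
    rcases he.after with h | h
    · rw [h, ← hA] at hlt
      omega
    · exact absurd ((hM.sorted _ t (not_lt.1 hlt) ht).trans hit.2.1) (not_le.2 h)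
  have key : NoHit lo hi μ c X Y 0 A ↔ NoHit lo hi μ c X Y (i * B) ((i + 1) * B) ∧
      NoHit lo hi μ c X Y (j * B) ((j + 1) * B) ∧
      (i + 1 < j → NoHit lo hi μ c X Y ((i + 1) * B) (j * B)) := by
    constructor
    · exact fun h => ⟨fun t _ h2 => h t (Nat.zero_le _) (by omega),
        fun t _ h2 => h t (Nat.zero_le _) (by omega),
        fun _ t _ h2 => h t (Nat.zero_le _) (by omega)⟩
    · rintro ⟨h1, h2, h3⟩ t - ht hit
      have h4 := hlow t ht hit
      have h5 := hhigh t ht hit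
      rcases Nat.lt_or_ge t ((i + 1) * B) with h6 | h6
      · exact h1 t h4 h6 hit
      · rcases Nat.lt_or_ge t (j * B) with h7 | h7
        · have : (i + 1) * B < j * B := h6.trans_lt h7
          exact h3 (Nat.lt_of_mul_lt_mul_right this) t h6 h7 hit
        · exact h2 t h7 h5 hit
  refine Runs.branch (by simp [e11, e12, hw0]; omega) (fun hlt => ?_) (fun hlt => ?_)
  · simp [e11, e12] at hlt
    refine (scanMiddle_runs hw hm hs₂ hl₂ hM he e11 e12 hlt).mono le_rfl ?_
    rintro s₃ ⟨-, h3⟩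
    rw [h3, hno, key, and_assoc]
    simp [hlt]
  · simp [e11, e12] at hlt
    refine Runs.of_wp ?_ (by simp [Prog.time])
    simp only [Prog.wp]
    rw [hno, key]
    simp [show ¬ i + 1 < j by omega]

/-! ### Preprocessing and correctness -/

/-- The preprocessing. -/
def preprocess : Prog :=
  .seq computeSizes <| .seq padInput <| .seq sortPoints <| .seq mirrorPoints buildTables

theorem preprocess_runs {n K : ℕ} (p : Fin n → ℝ × ℝ) (hK : K = Nat.clog 2 n)
    (hw : 4 * 2 ^ K + 8 < 2 ^ w) (hm : 2 * 2 ^ K + 1 < m) :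
    Runs w m preprocess (inputState p) (2 ^ K * (K + 1) * 2000) fun s =>
      ∃ B H X Y, Loaded B H X Y s ∧ Mirrored (2 ^ K) B H X Y ∧ B ≤ 2 * K + 1 ∧ H ≤ K ∧
        s.nreg 6 = n ∧ (n ≠ 0 → (∀ t < 2 ^ K, ∃ i, (X t, Y t) = p i) ∧
          ∀ i, ∃ t < 2 ^ K, (X t, Y t) = p i) := by
  have hw0 := word_ne_zero hw
  have hn : n ≤ 2 ^ K := hK ▸ Nat.le_pow_clog (by norm_num) n
  have hKlt : K < 2 ^ K := Nat.lt_two_pow_self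
  have h1K : 1 ≤ 2 ^ K := Nat.one_le_two_pow
  set A := 2 ^ K with hA
  unfold preprocess
  refine Runs.mono (T := K * 40 + 60 + (A * 30 + 20 + (K * (A * 200 + 80) + 20 + (A * 50 + 20 +
    (K * (A * 1000 + 80) + 20))))) ?_ (by nlinarith) (fun _ h => h)
  refine Runs.seq ((computeSizes_runs (K := K) hw hK (by simp [inputState])).mono le_rfl ?_)
  rintro s₁ ⟨hf₁, b, hbK, hKb, hbK', e1, e2, e3, e4, e5, e6⟩
  have e0 : s₁.nreg 0 = n := by rw [hf₁.n 0 (by decide)]; simp [inputState]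
  have x0 : s₁.rarr 0 = (inputState p).rarr 0 := hf₁.a 0 (by decide)
  have x1 : s₁.rarr 1 = (inputState p).rarr 1 := hf₁.a 1 (by decide)
  refine Runs.seq ((padInput_runs (A := A) hw hm e0 e2 hn).mono le_rfl ?_)
  rintro s₂ ⟨hf₂, hpad⟩
  refine Runs.seq ((sortPoints_runs (A := A) (K := K) hw hm
    (by rw [hf₂.n 2 (by decide), e2]) hA).mono le_rfl ?_)
  rintro s₃ ⟨hf₃, hsort, hrange⟩
  have f2 : s₃.nreg 2 = A := by rw [hf₃.n 2 (by decide), hf₂.n 2 (by decide), e2]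
  refine Runs.seq ((mirrorPoints_runs (A := A) hw hm f2).mono le_rfl ?_)
  rintro s₄ ⟨hf₄, hmir⟩
  have g2 : s₄.nreg 2 = A := by rw [hf₄.n 2 (by decide), f2]
  have g3 : s₄.nreg 3 = 2 ^ b := by
    rw [hf₄.n 3 (by decide), hf₃.n 3 (by decide), hf₂.n 3 (by decide), e3]
  have g4 : s₄.nreg 4 = 2 * 2 ^ (K - b) := by
    rw [hf₄.n 4 (by decide), hf₃.n 4 (by decide), hf₂.n 4 (by decide), e4]
  have g5 : s₄.nreg 5 = K - b := by
    rw [hf₄.n 5 (by decide), hf₃.n 5 (by decide), hf₂.n 5 (by decide), e5]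
  have g6 : s₄.nreg 6 = n := by
    rw [hf₄.n 6 (by decide), hf₃.n 6 (by decide), hf₂.n 6 (by decide), e6]
  have hAB : A = 2 ^ (K - b) * 2 ^ b := by rw [← pow_add, Nat.sub_add_cancel hbK]
  have hM : Mirrored A (2 ^ b) (K - b) (s₄.rarr 0) (s₄.rarr 1) := {
    size := hAB
    pos := by positivity
    le := by omega
    sorted := fun u v huv hv => by
      rw [(hmir u (by omega)).1.1, (hmir v hv).1.1]
      exact hsort u v huv hv
    mirror := fun t ht => by
      rw [(hmir t ht).1.1, (hmir t ht).1.2]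
      exact (hmir t ht).2 }
  refine (buildTables_runs (A := A) hw hm g2 g3 g4 g5 (by positivity) hAB (by omega) hM.sorted
    ?_).mono ?_ ?_
  · intro u v h1 h2 h3
    have hu := (hM.mirror (2 * A - (u + 1)) (by omega)).1
    have hv := (hM.mirror (2 * A - (v + 1)) (by omega)).1
    rw [show 2 * A - (2 * A - (u + 1) + 1) = u by omega] at hu
    rw [show 2 * A - (2 * A - (v + 1) + 1) = v by omega] at hv
    rw [hu, hv]
    exact neg_le_neg (hM.sorted _ _ (by omega) (by omega))
  · exact Nat.add_le_add_right (Nat.mul_le_mul_right _ (Nat.sub_le K b)) 20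
  rintro s₅ ⟨hf₅, hgood⟩
  have y0 : s₅.rarr 0 = s₄.rarr 0 := hf₅.a 0 (by decide)
  have y1 : s₅.rarr 1 = s₄.rarr 1 := hf₅.a 1 (by decide)
  refine ⟨2 ^ b, K - b, s₄.rarr 0, s₄.rarr 1, ⟨?_, ?_, y0, y1, hgood⟩, hM, hbK', by omega, ?_, ?_⟩
  · rw [hf₅.n 3 (by decide), g3]
  · rw [hf₅.n 4 (by decide), g4]
  · rw [hf₅.n 6 (by decide), g6]
  · intro hn0
    -- Padding cells repeat point 0, which exists because `n ≠ 0`; the set of points is unchanged.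
    have hpt : ∀ t < A, ∃ i, (s₂.rarr 0 t, s₂.rarr 1 t) = p i := by
      intro t ht
      rw [hpad 0 (by norm_num) t ht, hpad 1 (by norm_num) t ht, x0, x1]
      by_cases htn : t < n
      · exact ⟨⟨t, htn⟩, by simp [inputState, htn]⟩
      · exact ⟨⟨0, by omega⟩, by simp [inputState, htn, Nat.pos_of_ne_zero hn0]⟩
    constructor
    · intro t ht
      obtain ⟨u, hu, h1, h2⟩ := hrange.1 t ht
      obtain ⟨i, hi⟩ := hpt u hu
      exact ⟨i, by rw [(hmir t ht).1.1, (hmir t ht).1.2, h1, h2, hi]⟩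
    · intro i
      obtain ⟨t, ht, h1, h2⟩ := hrange.2 i (i.2.trans_le hn)
      refine ⟨t, ht, ?_⟩
      rw [(hmir t ht).1.1, (hmir t ht).1.2, h1, h2, hpad 0 (by norm_num) _ (i.2.trans_le hn),
        hpad 1 (by norm_num) _ (i.2.trans_le hn), x0, x1]
      simp [inputState, i.2]

open Filter Asymptotics

theorem noHit_iff_range_inter {n A : ℕ} (p : Fin n → ℝ × ℝ) {X Y : ℕ → ℝ}
    (h : ∀ t < A, ∃ i, (X t, Y t) = p i) (h' : ∀ i, ∃ t < A, (X t, Y t) = p i) (a b : ℝ × ℝ) :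
    NoHit (min a.1 b.1) (max a.1 b.1) ((b.2 - a.2) / (b.1 - a.1))
      (a.2 - (b.2 - a.2) / (b.1 - a.1) * a.1) X Y 0 A ↔
      Set.range p ∩ aboveSegment a b = ∅ := by
  have key : ∀ t, Hit (min a.1 b.1) (max a.1 b.1) ((b.2 - a.2) / (b.1 - a.1))
      (a.2 - (b.2 - a.2) / (b.1 - a.1) * a.1) X Y t ↔ (X t, Y t) ∈ aboveSegment a b := by
    intro t
    simp only [Hit, aboveSegment, Set.mem_ofPred_eq]
    refine and_congr Iff.rfl (and_congr Iff.rfl ?_)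
    constructor <;> intro h <;> linarith
  rw [Set.eq_empty_iff_forall_notMem]
  constructor
  · rintro hno _ ⟨⟨i, rfl⟩, hi⟩
    obtain ⟨t, ht, e⟩ := h' i
    exact hno t (Nat.zero_le _) ht ((key t).2 (e ▸ hi))
  · intro hno t _ ht hit
    obtain ⟨i, e⟩ := h t ht
    exact hno _ ⟨⟨i, e.symm⟩, (key t).1 hit⟩

/-- The memory holds a search structure for the points `p`. -/
def Ready {n : ℕ} (p : Fin n → ℝ × ℝ) (K : ℕ) (s : State) : Prop :=
  ∃ B H X Y, Loaded B H X Y s ∧ Mirrored (2 ^ K) B H X Y ∧ B ≤ 2 * K + 1 ∧ H ≤ K ∧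
    s.nreg 6 = n ∧ (n ≠ 0 → (∀ t < 2 ^ K, ∃ i, (X t, Y t) = p i) ∧
      ∀ i, ∃ t < 2 ^ K, (X t, Y t) = p i)

/-- A query writes to no real array and not to word registers 3, 4, 6, so the structure survives it.
The case `n = 0` is separate because padding then leaves a fictitious point at the origin; register
6 keeps `n` for this test, since register 0 receives the answers. -/
theorem Ready.query_runs {w m n K : ℕ} {p : Fin n → ℝ × ℝ} (hK : K = Nat.clog 2 n)
    (hw : 4 * 2 ^ K + 8 < 2 ^ w) (hm : 2 * 2 ^ K + 1 < m) {s : State} (hs : Ready p K s)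
    {a b : ℝ × ℝ} (hab : a.1 ≠ b.1) :
    Runs w m query (poseQuery s a b) (K * 720 + 1100) fun s' => Ready p K s' ∧
      (s'.nreg 0 = 0 ↔ Set.range p ∩ aboveSegment a b = ∅) := by
  obtain ⟨B, H, X, Y, hL, hM, hB, hH, h6, hp⟩ := hs
  have hn : n ≤ 2 ^ K := hK ▸ Nat.le_pow_clog (by norm_num) n
  have hL' : Loaded B H X Y (poseQuery s a b) :=
    ⟨by simp [poseQuery, hL.len], by simp [poseQuery, hL.num], by simp [poseQuery, hL.xs],
      by simp [poseQuery, hL.ys], by simpa [poseQuery] using hL.good⟩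
  have hready : ∀ s', Frame query (poseQuery s a b) s' → Ready p K s' := fun s' hf =>
    ⟨B, H, X, Y, hL'.frame hf (by decide) (by decide) (by decide), hM, hB, hH,
      by rw [hf.n 6 (by decide)]; simpa [poseQuery] using h6, hp⟩
  rcases eq_or_ne n 0 with rfl | hn0
  · have : Runs w m query (poseQuery s a b) (K * 720 + 1100) fun s' => s'.nreg 0 = 0 := by
      refine (Runs.branch (T := 2) ?_ (fun _ => Runs.of_wp ?_ (by decide))
        (fun h => absurd ?_ h)).mono (by simp [Test.cost, NExp.cost]) fun _ h => h
      · simp [poseQuery, h6]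
      · simp
      · simpa [poseQuery] using h6
    refine this.frame.mono le_rfl fun s' ⟨hf, h0⟩ => ⟨hready s' hf, ?_⟩
    simp [h0]
  · refine (RealRAM.query_runs hab hw hm hL hM (by omega) (by omega)).mono (by omega) ?_
    rintro s' ⟨hf, h0⟩
    exact ⟨hready s' hf, h0.trans (noHit_iff_range_inter p (hp hn0).1 (hp hn0).2 a b)⟩

theorem solvesSweeping {w m n K : ℕ} (p : Fin n → ℝ × ℝ) (hK : K = Nat.clog 2 n)
    (hw : 4 * 2 ^ K + 8 < 2 ^ w) (hm : 2 * 2 ^ K + 1 < m) :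
    SolvesSweeping w m (2 ^ K * (K + 1) * 2000) (K * 720 + 1100) preprocess query p := by
  refine ⟨Ready p K, preprocess_runs p hK hw hm, fun s hs a b hab => ?_⟩
  exact hs.query_runs hK hw hm hab

/-! ### Asymptotic bounds -/

theorem one_le_log_natCast {n : ℕ} (hn : 3 ≤ n) : 1 ≤ Real.log n := by
  rw [Real.le_log_iff_exp_le (by positivity)]
  exact Real.exp_one_lt_three.le.trans (by exact_mod_cast hn)

/-- From `2 ^ (clog - 1) < n` one gets `clog ≤ log n / log 2 + 1`. The summand 1 is absorbed by `1 ≤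
log n`, which is why `n ≥ 3` is required. -/
theorem clog_two_le {n : ℕ} (hn : 3 ≤ n) : (Nat.clog 2 n : ℝ) ≤ 3 * Real.log n := by
  have hlog := one_le_log_natCast hn
  have h1 : 2 ^ (Nat.clog 2 n - 1) < n := Nat.pow_pred_clog_lt_self (by norm_num) (by omega)
  have h2 : ((Nat.clog 2 n - 1 : ℕ) : ℝ) * Real.log 2 ≤ Real.log n := by
    rw [← Real.log_pow]
    exact Real.log_le_log (by positivity) (by exact_mod_cast h1.le)
  have h3 : (Nat.clog 2 n : ℝ) ≤ ((Nat.clog 2 n - 1 : ℕ) : ℝ) + 1 := by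
    exact_mod_cast (by omega : Nat.clog 2 n ≤ Nat.clog 2 n - 1 + 1)
  have h4 := Real.log_two_gt_d9
  nlinarith [Nat.cast_nonneg (α := ℝ) (Nat.clog 2 n - 1)]

theorem two_pow_clog_le {n : ℕ} (hn : 3 ≤ n) : ((2 ^ Nat.clog 2 n : ℕ) : ℝ) ≤ 2 * n := by
  have h1 : 2 ^ (Nat.clog 2 n - 1) < n := Nat.pow_pred_clog_lt_self (by norm_num) (by omega)
  have h2 : 0 < Nat.clog 2 n := Nat.clog_pos (by norm_num) (by omega)
  have h3 : 2 ^ Nat.clog 2 n = 2 * 2 ^ (Nat.clog 2 n - 1) := by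
    rw [← pow_succ', Nat.sub_add_cancel h2]
  exact_mod_cast (by omega : 2 ^ Nat.clog 2 n ≤ 2 * n)

theorem isBigO_of_le {f : ℕ → ℕ} {g : ℕ → ℝ} {C : ℝ}
    (h : ∀ᶠ n in atTop, (f n : ℝ) ≤ C * g n ∧ 0 ≤ g n) :
    (fun n => (f n : ℝ)) =O[atTop] g := by
  refine IsBigO.of_bound C ?_
  filter_upwards [h] with n hn
  rw [Real.norm_of_nonneg (Nat.cast_nonneg _), Real.norm_of_nonneg hn.2]
  exact hn.1

end RealRAM

/-- Two fixed programs, for all numbers of points, solve the problem with the stated preprocessing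
time, query time and number of memory cells per array (a program names only finitely many arrays),
on words of `O(log n)` bits. -/
theorem mainTheorem2 :
    ∃ pre query : RealRAM.Prog, ∃ tPre tQuery space word : ℕ → ℕ,
      (fun n : ℕ => (tPre n : ℝ)) =O[Filter.atTop] (fun n : ℕ => (n : ℝ) * Real.log n) ∧
      (fun n : ℕ => (tQuery n : ℝ)) =O[Filter.atTop] (fun n : ℕ => Real.log n) ∧
      (fun n : ℕ => (space n : ℝ)) =O[Filter.atTop]
        (fun n : ℕ => (n : ℝ) * Real.log (Real.log n)) ∧
      (fun n : ℕ => (word n : ℝ)) =O[Filter.atTop] (fun n : ℕ => Real.log n) ∧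
      ∀ (n : ℕ) (p : Fin n → ℝ × ℝ),
        SolvesSweeping (word n) (space n) (tPre n) (tQuery n) pre query p := by
  refine ⟨RealRAM.preprocess, RealRAM.query, fun n => 2 ^ Nat.clog 2 n * (Nat.clog 2 n + 1) * 2000,
    fun n => Nat.clog 2 n * 720 + 1100, fun n => 2 * 2 ^ Nat.clog 2 n + 2,
    fun n => Nat.clog 2 n + 4, ?_, ?_, ?_, ?_, fun n p => RealRAM.solvesSweeping p rfl ?_ ?_⟩
  · refine RealRAM.isBigO_of_le (C := 16000) ?_
    filter_upwards [Filter.eventually_ge_atTop 3] with n hn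
    have h1 := RealRAM.clog_two_le hn
    have h2 := RealRAM.two_pow_clog_le hn
    have h3 := RealRAM.one_le_log_natCast hn
    refine ⟨?_, by positivity⟩
    rw [Nat.cast_mul, Nat.cast_mul, Nat.cast_add]
    calc ((2 ^ Nat.clog 2 n : ℕ) : ℝ) * ((Nat.clog 2 n : ℝ) + (1 : ℕ)) * (2000 : ℕ)
        ≤ (2 * n) * (3 * Real.log n + Real.log n) * (2000 : ℕ) := by
          gcongr
          simpa using h3
      _ = 16000 * (n * Real.log n) := by push_cast; ring
  -- `3260 = 3 * 720 + 1100`, by `clog ≤ 3 log n` and `1 ≤ log n`.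
  · refine RealRAM.isBigO_of_le (C := 3260) ?_
    filter_upwards [Filter.eventually_ge_atTop 3] with n hn
    have h1 := RealRAM.clog_two_le hn
    have h3 := RealRAM.one_le_log_natCast hn
    push_cast
    exact ⟨by linarith, by linarith⟩
  · refine RealRAM.isBigO_of_le (C := 6) ?_
    -- The space is at most `4 * n + 2 ≤ 6 * n`, hence linear; the factor `log (log n)` only has to
    -- be eventually at least 1.
    have hll : ∀ᶠ n : ℕ in Filter.atTop, 1 ≤ Real.log (Real.log n) :=
      (Real.tendsto_log_atTop.comp (Real.tendsto_log_atTop.comp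
        tendsto_natCast_atTop_atTop)).eventually_ge_atTop 1
    filter_upwards [Filter.eventually_ge_atTop 3, hll] with n hn hlog
    have h2 := RealRAM.two_pow_clog_le hn
    have hn' : (3 : ℝ) ≤ n := by exact_mod_cast hn
    rw [Nat.cast_add, Nat.cast_mul]
    push_cast at h2 ⊢
    exact ⟨by nlinarith, by positivity⟩
  · refine RealRAM.isBigO_of_le (C := 7) ?_
    filter_upwards [Filter.eventually_ge_atTop 3] with n hn
    have h1 := RealRAM.clog_two_le hn
    have h3 := RealRAM.one_le_log_natCast hn
    push_cast
    exact ⟨by linarith, by linarith⟩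
  -- Four extra bits suffice: `4 * 2 ^ K + 8 < 16 * 2 ^ K`.
  · have : 1 ≤ 2 ^ Nat.clog 2 n := Nat.one_le_two_pow
    rw [pow_add]
    omega
  · exact Nat.lt_succ_self _
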